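/- Let $R$ be a commutative ring with identity. For finite groups $G,H$, a finite $(G,H)$-biset is a finite set with commuting left $G$-action and right $H$-action, and $RB(G,H)=R\otimes_{\mathbb Z}B(G,H)$, where $B(G,H)$ is the Grothendieck group of finite $(G,H)$-bisets with respect to disjoint union. The category $R\mathcal C$ has the finite groups as objects, $\mathrm{Hom}_{R\mathcal C}(G,H)=RB(H,G)$, composition induced by $(U,V)\mapsto U\times_H V=(U\times V)/\big((uh,v)\sim(u,hv)\big)$, and the class of the $(G,G)$-biset $G$ as identity of $G$. A biset functor over $R$ is an $R$-linear functor $F$ from $R\mathcal C$ to $R$-modules. For $H\le G$, $\mathrm{Res}_H^G:F(G)\to F(H)$ is the map induced by the set $G$ viewed as an $(H,G)$-biset; for $N\trianglelefteq G$, $\mathrm{Def}_{G/N}^G:F(G)\to F(G/N)$ is the map induced by the set $G/N$ viewed as a $(G/N,G)$-biset. Let $G$ be a finite group whose order is invertible in $R$, and let $\Phi(G)$ be its Frattini subgroup. Let $$e_G^G=\frac1{|G|}\sum_{K\le G}|K|\,\mu(K,G)\,[G/K]\in RB(G)=R\otimes_{\mathbb Z}B(G),$$ where $B(G)$ is the Grothendieck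 group of finite $G$-sets and $\mu$ is the Möbius function of the poset of subgroups of $G$. Let $\alpha\mapsto\widetilde\alpha$ be the $R$-linear map $RB(G)\to RB(G,G)$ sending the class of a finite $G$-set $X$ to the class of $G\times X$ with $a(g,x)b=(agb,ax)$. For $M\trianglelefteq G$ let $\Delta_M(G)=\{(a,b)\in G\times G\mid ab^{-1}\in M\}$ and let $(G\times G)/\Delta_M(G)$ be the $(G,G)$-biset with $a\cdot(g,h)\Delta_M(G)\cdot b=(ag,b^{-1}h)\Delta_M(G)$. Set $$\varphi_{\mathbf 1}^G=\sum_{\substack{M\trianglelefteq G\\ M\le\Phi(G)}}\mu_{\trianglelefteq G}(\mathbf 1,M)\;\widetilde{e_G^G}\,[(G\times G)/\Delta_M(G)]\,\widetilde{e_G^G}\in RB(G,G),$$ where $\mu_{\trianglelefteq G}$ is the Möbius function of the poset of normal subgroups of $G$. For a biset functor $F$ over $R$, let $\delta_\Phi F(G)=\varphi_{\mathbf 1}^G F(G)$, the image of $F(\varphi_{\mathbf 1}^G):F(G)\to F(G)$. Then, for every biset functor $F$ over $R$, the $R$-submodule $\delta_\Phi F(G)$ of $F(G)$ is exactly the set of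 all $u\in F(G)$ such that $\mathrm{Res}_H^G u=0$ for every proper subgroup $H<G$, and $\mathrm{Def}_{G/N}^G u=0$ for every normal subgroup $N\trianglelefteq G$ with $N\cap\Phi(G)\neq\mathbf 1$. -/

import Mathlib

open CategoryTheory MulOpposite
open scoped TensorProduct

universe u v w

noncomputable section

namespace BisetFunctors

/-! ### Finite `X`-sets and their Grothendieck group -/

/-- A finite (left) `X`-set. -/
structure FinGSet (X : Type u) [Group X] : Type (u + 1) where
  carrier : Type u
  [finite : Finite carrier]
  [action : MulAction X carrier]

attribute [instance] FinGSet.finite FinGSet.action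

/-- Two finite `X`-sets are isomorphic if there is an equivariant bijection between them. -/
def FinGSet.Iso {X : Type u} [Group X] (A B : FinGSet X) : Prop :=
  ∃ e : A.carrier ≃ B.carrier, ∀ (x : X) (a : A.carrier), e (x • a) = x • e a

theorem FinGSet.Iso.equivalence (X : Type u) [Group X] :
    Equivalence (FinGSet.Iso (X := X)) where
  refl _ := ⟨Equiv.refl _, fun _ _ => rfl⟩
  symm := fun ⟨e, he⟩ => ⟨e.symm, fun x b => by
    rw [Equiv.symm_apply_eq, he, Equiv.apply_symm_apply]⟩
  trans := fun ⟨e, he⟩ ⟨f, hf⟩ => ⟨e.trans f, fun x a => by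
    simp only [Equiv.trans_apply, he, hf]⟩

instance FinGSet.isoSetoid (X : Type u) [Group X] : Setoid (FinGSet X) :=
  ⟨FinGSet.Iso, FinGSet.Iso.equivalence X⟩

/-- Disjoint union of finite `X`-sets. -/
def FinGSet.sum {X : Type u} [Group X] (A B : FinGSet X) : FinGSet X where
  carrier := A.carrier ⊕ B.carrier
  action :=
    { smul := fun x => Sum.map (x • ·) (x • ·)
      one_smul := by
        rintro (a | a)
        · exact congrArg Sum.inl (one_smul X a)
        · exact congrArg Sum.inr (one_smul X a)
      mul_smul := by
        rintro x y (a | a)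
        · exact congrArg Sum.inl (mul_smul x y a)
        · exact congrArg Sum.inr (mul_smul x y a) }

/-- The empty `X`-set. -/
def FinGSet.empty (X : Type u) [Group X] : FinGSet X where
  carrier := PEmpty
  action :=
    { smul := fun _ a => a
      one_smul := fun _ => rfl
      mul_smul := fun _ _ _ => rfl }

instance (X : Type u) [Group X] : IsEmpty (FinGSet.empty X).carrier :=
  inferInstanceAs (IsEmpty PEmpty)

theorem FinGSet.sum_congr {X : Type u} [Group X] {A A' B B' : FinGSet X}
    (hA : A.Iso A') (hB : B.Iso B') : (A.sum B).Iso (A'.sum B') := by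
  obtain ⟨e, he⟩ := hA
  obtain ⟨f, hf⟩ := hB
  refine ⟨Equiv.sumCongr e f, ?_⟩
  rintro x (a | b)
  · exact congrArg Sum.inl (he x a)
  · exact congrArg Sum.inr (hf x b)

/-- The monoid of isomorphism classes of finite `X`-sets, under disjoint union. -/
def BurnsideMonoid (X : Type u) [Group X] : Type (u + 1) :=
  Quotient (FinGSet.isoSetoid X)

namespace BurnsideMonoid

variable {X : Type u} [Group X]

/-- The isomorphism class of a finite `X`-set. -/
def mk (A : FinGSet X) : BurnsideMonoid X := Quotient.mk _ A

theorem mk_eq {A B : FinGSet X} (h : A.Iso B) : mk A = mk B := Quotient.sound h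

instance : Add (BurnsideMonoid X) :=
  ⟨Quotient.map₂ FinGSet.sum fun _ _ hA _ _ hB => FinGSet.sum_congr hA hB⟩

instance : Zero (BurnsideMonoid X) := ⟨mk (FinGSet.empty X)⟩

instance : AddCommMonoid (BurnsideMonoid X) where
  add_assoc := by
    rintro ⟨A⟩ ⟨B⟩ ⟨C⟩
    refine mk_eq ⟨Equiv.sumAssoc _ _ _, ?_⟩
    rintro x ((a | b) | c) <;> rfl
  zero_add := by
    rintro ⟨A⟩
    refine mk_eq ⟨Equiv.emptySum _ _, ?_⟩
    rintro x (⟨⟨⟩⟩ | a); rfl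
  add_zero := by
    rintro ⟨A⟩
    refine mk_eq ⟨Equiv.sumEmpty _ _, ?_⟩
    rintro x (a | ⟨⟨⟩⟩); rfl
  add_comm := by
    rintro ⟨A⟩ ⟨B⟩
    refine mk_eq ⟨Equiv.sumComm _ _, ?_⟩
    rintro x (a | b) <;> rfl
  nsmul := nsmulRec

theorem mk_sum (A B : FinGSet X) : mk (A.sum B) = mk A + mk B := rfl

end BurnsideMonoid

/-- The Burnside group of `X`: the Grothendieck group of finite `X`-sets for disjoint union. -/
abbrev BurnsideGroup (X : Type u) [Group X] : Type (u + 1) :=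
  Algebra.GrothendieckAddGroup (BurnsideMonoid X)

/-- `R ⊗_ℤ B(X)`. -/
abbrev RBurnside (R : Type v) [CommRing R] (X : Type u) [Group X] : Type (max (u + 1) v) :=
  R ⊗[ℤ] BurnsideGroup X

namespace RBurnside

variable (R : Type v) [CommRing R] {X : Type u} [Group X]

/-- The image in `R ⊗_ℤ B(X)` of an isomorphism class of finite `X`-sets. -/
def ofMonoid : BurnsideMonoid X →+ RBurnside R X :=
  ((TensorProduct.mk ℤ R (BurnsideGroup X) 1).toAddMonoidHom).comp
    Algebra.GrothendieckAddGroup.of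

/-- The class `[A]` of a finite `X`-set `A` in `R ⊗_ℤ B(X)`. -/
def cls (A : FinGSet X) : RBurnside R X := ofMonoid R (BurnsideMonoid.mk A)

variable {R}

/-- The `R`-linear extension to `R ⊗_ℤ B(X)` of an additive map on isomorphism classes. -/
def lift {V : Type*} [AddCommGroup V] [Module R V] (f : BurnsideMonoid X →+ V) :
    RBurnside R X →ₗ[R] V :=
  LinearMap.liftBaseChange R (Algebra.GrothendieckAddGroup.lift f).toIntLinearMap

theorem lift_ofMonoid {V : Type*} [AddCommGroup V] [Module R V] (f : BurnsideMonoid X →+ V)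
    (m : BurnsideMonoid X) : lift f (ofMonoid R m) = f m := by
  have h : Algebra.GrothendieckAddGroup.lift f (Algebra.GrothendieckAddGroup.of m) = f m :=
    DFunLike.congr_fun (Algebra.GrothendieckAddGroup.lift.symm_apply_apply f) m
  have h' : lift f (ofMonoid R m) =
      (1 : R) • Algebra.GrothendieckAddGroup.lift f (Algebra.GrothendieckAddGroup.of m) :=
    LinearMap.liftBaseChange_tmul (A := R) _ _ _
  rw [h', one_smul, h]

theorem lift_cls {V : Type*} [AddCommGroup V] [Module R V] (f : BurnsideMonoid X →+ V)
    (A : FinGSet X) : lift f (cls R A) = f (BurnsideMonoid.mk A) := lift_ofMonoid f _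

theorem linearMap_ext {V : Type*} [AddCommGroup V] [Module R V] {f g : RBurnside R X →ₗ[R] V}
    (h : ∀ A : FinGSet X, f (cls R A) = g (cls R A)) : f = g := by
  apply TensorProduct.AlgebraTensorModule.ext
  intro r b
  have key : (f.toAddMonoidHom.comp
      (TensorProduct.mk ℤ R (BurnsideGroup X) 1).toAddMonoidHom) =
      (g.toAddMonoidHom.comp (TensorProduct.mk ℤ R (BurnsideGroup X) 1).toAddMonoidHom) := by
    apply Algebra.GrothendieckAddGroup.lift.symm.injective
    ext m
    induction m using Quotient.inductionOn with
    | h A => exact h A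
  have hr : r ⊗ₜ[ℤ] b = r • ((1 : R) ⊗ₜ[ℤ] b) := by
    rw [TensorProduct.smul_tmul', smul_eq_mul, mul_one]
  rw [hr, map_smul, map_smul]
  exact congrArg (r • ·) (DFunLike.congr_fun key b)

end RBurnside

/-! ### Bisets and their composition

A `(G, H)`-biset is a `G × Hᵐᵒᵖ`-set: `g · u · h` is `(g, op h) • u`. -/

/-- Finite `(G, H)`-bisets. -/
abbrev FinBiset (G H : Type u) [Group G] [Group H] : Type (u + 1) := FinGSet (G × Hᵐᵒᵖ)

namespace FinBiset

variable {K H G J : Type u} [Group K] [Group H] [Group G] [Group J]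

/-- The equivalence relation on `U × V` whose classes are the orbits of
`(u, v) · h = (u h, h⁻¹ v)`. -/
def prodSetoid (U : FinBiset K H) (V : FinBiset H G) : Setoid (U.carrier × V.carrier) where
  r p q := ∃ h : H, ((1, op h) : K × Hᵐᵒᵖ) • p.1 = q.1 ∧ ((h⁻¹, 1) : H × Gᵐᵒᵖ) • p.2 = q.2
  iseqv :=
    { refl := fun p => ⟨1, by simp [← Prod.one_eq_mk]⟩
      symm := by
        rintro ⟨u, v⟩ ⟨u', v'⟩ ⟨h, rfl, rfl⟩
        exact ⟨h⁻¹, by simp [← mul_smul, ← Prod.one_eq_mk],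
          by simp [← mul_smul, ← Prod.one_eq_mk]⟩
      trans := by
        rintro ⟨u, v⟩ ⟨u', v'⟩ ⟨u'', v''⟩ ⟨h, rfl, rfl⟩ ⟨k, rfl, rfl⟩
        exact ⟨h * k, by simp [← mul_smul], by simp [← mul_smul]⟩ }

theorem prodSetoid_smul (U : FinBiset K H) (V : FinBiset H G) (k : K) (g : G)
    {p q : U.carrier × V.carrier} (hpq : prodSetoid U V p q) :
    prodSetoid U V (((k, 1) : K × Hᵐᵒᵖ) • p.1, ((1, op g) : H × Gᵐᵒᵖ) • p.2)
      (((k, 1) : K × Hᵐᵒᵖ) • q.1, ((1, op g) : H × Gᵐᵒᵖ) • q.2) := by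
  obtain ⟨u, v⟩ := p
  obtain ⟨u', v'⟩ := q
  obtain ⟨h, rfl, rfl⟩ := hpq
  exact ⟨h, by simp [← mul_smul], by simp [← mul_smul]⟩

/-- The composition `U ×_H V` of a `(K, H)`-biset and an `(H, G)`-biset, with
`k · [u, v] · g = [k u, v g]`. -/
def prod (U : FinBiset K H) (V : FinBiset H G) : FinBiset K G where
  carrier := Quotient (prodSetoid U V)
  finite := Quotient.finite _
  action :=
    { smul := fun x => Quotient.map
        (fun p => (((x.1, 1) : K × Hᵐᵒᵖ) • p.1, ((1, x.2) : H × Gᵐᵒᵖ) • p.2))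
        (fun _ _ h => prodSetoid_smul U V x.1 x.2.unop h)
      one_smul := by
        rintro ⟨u, v⟩
        refine congrArg (Quotient.mk (prodSetoid U V)) (Prod.ext ?_ ?_)
        · exact one_smul _ u
        · exact one_smul _ v
      mul_smul := by
        rintro x y ⟨u, v⟩
        refine congrArg (Quotient.mk (prodSetoid U V)) (Prod.ext ?_ ?_)
        · simp [← mul_smul]
        · simp [← mul_smul] }

/-- The class of `(u, v)` in `U ×_H V`. -/
def prodMk (U : FinBiset K H) (V : FinBiset H G) (u : U.carrier) (v : V.carrier) :
    (prod U V).carrier := Quotient.mk (prodSetoid U V) (u, v)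

theorem smul_prodMk (U : FinBiset K H) (V : FinBiset H G) (x : K × Gᵐᵒᵖ) (u : U.carrier)
    (v : V.carrier) : x • prodMk U V u v =
      prodMk U V (((x.1, 1) : K × Hᵐᵒᵖ) • u) (((1, x.2) : H × Gᵐᵒᵖ) • v) := rfl

theorem prodMk_balanced (U : FinBiset K H) (V : FinBiset H G) (h : H) (u : U.carrier)
    (v : V.carrier) :
    prodMk U V (((1, op h) : K × Hᵐᵒᵖ) • u) v = prodMk U V u (((h, 1) : H × Gᵐᵒᵖ) • v) := by
  refine Quotient.sound ⟨h⁻¹, ?_, ?_⟩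
  · simp [← mul_smul, ← Prod.one_eq_mk]
  · simp

/-- Maps out of `U ×_H V` are balanced maps out of `U × V`. -/
def prodLift {U : FinBiset K H} {V : FinBiset H G} {T : Type*}
    (f : U.carrier → V.carrier → T)
    (hf : ∀ (h : H) u v, f (((1, op h) : K × Hᵐᵒᵖ) • u) v = f u (((h, 1) : H × Gᵐᵒᵖ) • v)) :
    (prod U V).carrier → T :=
  Quotient.lift (fun p => f p.1 p.2) (by
    rintro ⟨u, v⟩ ⟨u', v'⟩ ⟨h, rfl, rfl⟩
    simp [hf, ← mul_smul, ← Prod.one_eq_mk])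

theorem prod_ind {U : FinBiset K H} {V : FinBiset H G} {P : (prod U V).carrier → Prop}
    (h : ∀ u v, P (prodMk U V u v)) (x : (prod U V).carrier) : P x := by
  obtain ⟨u, v⟩ := x
  exact h u v

theorem prod_congr {U U' : FinBiset K H} {V V' : FinBiset H G}
    (hU : U.Iso U') (hV : V.Iso V') : (prod U V).Iso (prod U' V') := by
  obtain ⟨e, he⟩ := hU
  obtain ⟨f, hf⟩ := hV
  have hes : ∀ (x : K × Hᵐᵒᵖ) b, e.symm (x • b) = x • e.symm b := fun x b => by
    rw [Equiv.symm_apply_eq, he, Equiv.apply_symm_apply]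
  have hfs : ∀ (x : H × Gᵐᵒᵖ) b, f.symm (x • b) = x • f.symm b := fun x b => by
    rw [Equiv.symm_apply_eq, hf, Equiv.apply_symm_apply]
  refine ⟨⟨prodLift (fun u v => prodMk U' V' (e u) (f v)) ?_,
    prodLift (fun u v => prodMk U V (e.symm u) (f.symm v)) ?_, ?_, ?_⟩, ?_⟩
  · intro h u v; rw [he, hf, prodMk_balanced]
  · intro h u v; rw [hes, hfs, prodMk_balanced]
  · refine prod_ind fun u v => ?_
    change prodMk U V (e.symm (e u)) (f.symm (f v)) = _
    simp
  · refine prod_ind fun u v => ?_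
    change prodMk U' V' (e (e.symm u)) (f (f.symm v)) = _
    simp
  · intro x
    refine prod_ind fun u v => ?_
    change prodMk U' V' (e _) (f _) = x • prodMk U' V' (e u) (f v)
    rw [he, hf, smul_prodMk]

theorem sum_prod (U U' : FinBiset K H) (V : FinBiset H G) :
    (prod (U.sum U') V).Iso ((prod U V).sum (prod U' V)) := by
  refine ⟨⟨prodLift (fun u v => Sum.map (fun u => prodMk U V u v) (fun u => prodMk U' V u v) u)
      ?_,
    Sum.elim (prodLift (fun u v => prodMk (U.sum U') V (Sum.inl u) v) ?_)
      (prodLift (fun u v => prodMk (U.sum U') V (Sum.inr u) v) ?_), ?_, ?_⟩, ?_⟩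
  · rintro h (u | u) v
    · exact congrArg Sum.inl (prodMk_balanced U V h u v)
    · exact congrArg Sum.inr (prodMk_balanced U' V h u v)
  · intro h u v; exact prodMk_balanced (U.sum U') V h (Sum.inl u) v
  · intro h u v; exact prodMk_balanced (U.sum U') V h (Sum.inr u) v
  · refine prod_ind ?_
    rintro (u | u) v <;> rfl
  · rintro (p | p)
    · revert p; refine prod_ind ?_; intro u v; rfl
    · revert p; refine prod_ind ?_; intro u v; rfl
  · intro x
    refine prod_ind ?_
    rintro (u | u) v <;> rfl

theorem prod_sum (U : FinBiset K H) (V V' : FinBiset H G) :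
    (prod U (V.sum V')).Iso ((prod U V).sum (prod U V')) := by
  refine ⟨⟨prodLift (fun u v => Sum.map (fun v => prodMk U V u v) (fun v => prodMk U V' u v) v)
      ?_,
    Sum.elim (prodLift (fun u v => prodMk U (V.sum V') u (Sum.inl v)) ?_)
      (prodLift (fun u v => prodMk U (V.sum V') u (Sum.inr v)) ?_), ?_, ?_⟩, ?_⟩
  · rintro h u (v | v)
    · exact congrArg Sum.inl (prodMk_balanced U V h u v)
    · exact congrArg Sum.inr (prodMk_balanced U V' h u v)
  · intro h u v; exact prodMk_balanced U (V.sum V') h u (Sum.inl v)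
  · intro h u v; exact prodMk_balanced U (V.sum V') h u (Sum.inr v)
  · refine prod_ind ?_
    rintro u (v | v) <;> rfl
  · rintro (p | p)
    · revert p; refine prod_ind ?_; intro u v; rfl
    · revert p; refine prod_ind ?_; intro u v; rfl
  · intro x
    refine prod_ind ?_
    rintro u (v | v) <;> rfl

theorem empty_prod (V : FinBiset H G) :
    (prod (FinGSet.empty (K × Hᵐᵒᵖ)) V).Iso (FinGSet.empty (K × Gᵐᵒᵖ)) :=
  ⟨⟨prodLift (fun u _ => u) (fun _ u _ => u.elim), fun u => u.elim,
    prod_ind fun u _ => u.elim, fun u => u.elim⟩, fun _ => prod_ind fun u _ => u.elim⟩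

theorem prod_empty (U : FinBiset K H) :
    (prod U (FinGSet.empty (H × Gᵐᵒᵖ))).Iso (FinGSet.empty (K × Gᵐᵒᵖ)) :=
  ⟨⟨prodLift (fun _ v => v) (fun _ _ v => v.elim), fun v => v.elim,
    prod_ind fun _ v => v.elim, fun v => v.elim⟩, fun _ => prod_ind fun _ v => v.elim⟩

theorem prod_assoc (U : FinBiset J K) (V : FinBiset K H) (W : FinBiset H G) :
    (prod (prod U V) W).Iso (prod U (prod V W)) := by
  refine ⟨⟨prodLift (fun p w => prodLift (fun u v => prodMk U (prod V W) u (prodMk V W v w))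
      ?_ p) ?_,
    prodLift (fun u q => prodLift (fun v w => prodMk (prod U V) W (prodMk U V u v) w) ?_ q) ?_,
      ?_, ?_⟩, ?_⟩
  · intro k u v
    rw [prodMk_balanced, smul_prodMk]
    simp [← Prod.one_eq_mk]
  · intro h p w
    revert p
    refine prod_ind fun u v => ?_
    change prodMk U (prod V W) _ (prodMk V W _ w) = prodMk U (prod V W) u (prodMk V W v _)
    rw [← prodMk_balanced]
    simp [← Prod.one_eq_mk]
  · intro h v w
    rw [← prodMk_balanced, smul_prodMk]
    simp [← Prod.one_eq_mk]
  · intro k u q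
    revert q
    refine prod_ind fun v w => ?_
    change prodMk (prod U V) W (prodMk U V _ v) w = prodMk (prod U V) W (prodMk U V u _) _
    rw [prodMk_balanced]
    simp [← Prod.one_eq_mk]
  · refine prod_ind fun p w => ?_
    revert p
    exact prod_ind fun u v => rfl
  · refine prod_ind fun u q => ?_
    revert q
    exact prod_ind fun v w => rfl
  · intro x
    refine prod_ind fun p w => ?_
    revert p
    refine prod_ind fun u v => ?_
    change prodMk U (prod V W) (((x.1, 1) : J × Kᵐᵒᵖ) • u)
      (prodMk V W (((1, 1) : K × Hᵐᵒᵖ) • v) (((1, x.2) : H × Gᵐᵒᵖ) • w)) =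
      prodMk U (prod V W) (((x.1, 1) : J × Kᵐᵒᵖ) • u)
      (prodMk V W (((1, 1) : K × Hᵐᵒᵖ) • v) (((1, x.2) : H × Gᵐᵒᵖ) • w))
    rfl

/-- The set underlying `T`, with `g · t · h = α g * t * β h` for homomorphisms
`α : G →* T`, `β : H →* T`. -/
def ofHoms {T : Type u} [Group T] [Finite T] (α : G →* T) (β : H →* T) : FinBiset G H where
  carrier := T
  action :=
    { smul := fun x t => α x.1 * t * β x.2.unop
      one_smul := fun t => by change α 1 * t * β 1 = t; simp
      mul_smul := fun x y t => by
        change α (x.1 * y.1) * t * β (y.2.unop * x.2.unop) =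
          α x.1 * (α y.1 * t * β y.2.unop) * β x.2.unop
        simp [mul_assoc] }

/-- The identity biset of `G`: the set `G`, by left and right multiplication. -/
def idBiset (G : Type u) [Group G] [Finite G] : FinBiset G G :=
  ofHoms (MonoidHom.id G) (MonoidHom.id G)

theorem id_prod [Finite H] (V : FinBiset H G) : (prod (idBiset H) V).Iso V := by
  refine ⟨⟨prodLift (fun (h : H) v => ((h, 1) : H × Gᵐᵒᵖ) • v) ?_,
    fun v => prodMk (idBiset H) V (1 : H) v, ?_, ?_⟩, ?_⟩
  · intro h (k : H) v
    change (((1 * k * h : H), 1) : H × Gᵐᵒᵖ) • v = _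
    simp [← mul_smul]
  · refine prod_ind fun (h : H) v => ?_
    refine (prodMk_balanced (idBiset H) V h (1 : H) v).symm.trans ?_
    have : (1 * 1 * h : H) = h := by simp
    exact congrArg (fun t : H => prodMk (idBiset H) V t v) this
  · intro v
    exact one_smul _ v
  · intro x
    refine prod_ind fun (h : H) v => ?_
    change (((x.1 * h * 1 : H), 1) : H × Gᵐᵒᵖ) • (((1, x.2) : H × Gᵐᵒᵖ) • v) =
      x • (((h, 1) : H × Gᵐᵒᵖ) • v)
    obtain ⟨a, b⟩ := x
    simp [← mul_smul]

theorem prod_id [Finite H] (U : FinBiset K H) : (prod U (idBiset H)).Iso U := by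
  refine ⟨⟨prodLift (fun u (h : H) => ((1, op h) : K × Hᵐᵒᵖ) • u) ?_,
    fun u => prodMk U (idBiset H) u (1 : H), ?_, ?_⟩, ?_⟩
  · intro h u (k : H)
    change _ = ((1, op (h * k * 1 : H)) : K × Hᵐᵒᵖ) • u
    simp [← mul_smul]
  · refine prod_ind fun u (h : H) => ?_
    refine (prodMk_balanced U (idBiset H) h u (1 : H)).trans ?_
    have : (h * 1 * 1 : H) = h := by simp
    exact congrArg (fun t : H => prodMk U (idBiset H) u t) this
  · intro u
    exact one_smul _ u
  · intro x
    refine prod_ind fun u (h : H) => ?_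
    change ((1, op (1 * h * x.2.unop : H)) : K × Hᵐᵒᵖ) • (((x.1, 1) : K × Hᵐᵒᵖ) • u) =
      x • (((1, op h) : K × Hᵐᵒᵖ) • u)
    obtain ⟨a, b⟩ := x
    simp [← mul_smul]

end FinBiset

/-! ### The category `RC` -/

/-- `RB(G, H) = R ⊗_ℤ B(G, H)`, where `B(G, H)` is the Grothendieck group of finite
`(G, H)`-bisets. -/
abbrev RB (R : Type v) [CommRing R] (G H : Type u) [Group G] [Group H] :
    Type (max (u + 1) v) :=
  RBurnside R (G × Hᵐᵒᵖ)

section Composition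

variable {K H G J : Type u} [Group K] [Group H] [Group G] [Group J]

/-- The biadditive map induced by `(U, V) ↦ U ×_H V` on isomorphism classes. -/
def monoidProd : BurnsideMonoid (K × Hᵐᵒᵖ) →+ BurnsideMonoid (H × Gᵐᵒᵖ) →+
    BurnsideMonoid (K × Gᵐᵒᵖ) where
  toFun := fun a =>
    { toFun := fun b => Quotient.map₂ FinBiset.prod
        (fun _ _ hU _ _ hV => FinBiset.prod_congr hU hV) a b
      map_zero' := by
        obtain ⟨U⟩ := a
        exact BurnsideMonoid.mk_eq (FinBiset.prod_empty U)
      map_add' := by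
        obtain ⟨U⟩ := a
        rintro ⟨V⟩ ⟨V'⟩
        exact BurnsideMonoid.mk_eq (FinBiset.prod_sum U V V') }
  map_zero' := by
    ext ⟨V⟩
    exact BurnsideMonoid.mk_eq (FinBiset.empty_prod V)
  map_add' := by
    rintro ⟨U⟩ ⟨U'⟩
    ext ⟨V⟩
    exact BurnsideMonoid.mk_eq (FinBiset.sum_prod U U' V)

theorem monoidProd_mk (U : FinBiset K H) (V : FinBiset H G) :
    monoidProd (BurnsideMonoid.mk U) (BurnsideMonoid.mk V) =
      BurnsideMonoid.mk (FinBiset.prod U V) := rfl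

variable (R : Type v) [CommRing R]

/-- The `R`-bilinear product `×_H : RB(K, H) × RB(H, G) → RB(K, G)`. -/
def comp : RB R K H →ₗ[R] RB R H G →ₗ[R] RB R K G :=
  RBurnside.lift
    { toFun := fun a => RBurnside.lift ((RBurnside.ofMonoid R).comp (monoidProd a))
      map_zero' := RBurnside.linearMap_ext fun V => by
        rw [RBurnside.lift_cls]
        simp
      map_add' := fun a b => RBurnside.linearMap_ext fun V => by
        rw [LinearMap.add_apply, RBurnside.lift_cls, RBurnside.lift_cls, RBurnside.lift_cls]
        simp }

theorem comp_cls (U : FinBiset K H) (V : FinBiset H G) :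
    comp R (RBurnside.cls R U) (RBurnside.cls R V) = RBurnside.cls R (FinBiset.prod U V) := by
  rw [comp, RBurnside.lift_cls]
  exact RBurnside.lift_cls _ V

theorem comp_assoc (a : RB R J K) (b : RB R K H) (c : RB R H G) :
    comp R (comp R a b) c = comp R a (comp R b c) := by
  have : (LinearMap.compr₂ (comp R (K := J) (H := K) (G := H)) (comp R (G := G))) =
      (LinearMap.llcomp R (RB R H G) (RB R K G) (RB R J G)).flip.flip.compl₁₂
        (comp R) (comp R) := by
    refine RBurnside.linearMap_ext fun U => RBurnside.linearMap_ext fun V =>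
      RBurnside.linearMap_ext fun W => ?_
    simp only [LinearMap.compr₂_apply, LinearMap.compl₁₂_apply, LinearMap.flip_apply,
      LinearMap.llcomp_apply, comp_cls]
    exact congrArg (RBurnside.ofMonoid R) (BurnsideMonoid.mk_eq (FinBiset.prod_assoc U V W))
  exact LinearMap.congr_fun (LinearMap.congr_fun (LinearMap.congr_fun this a) b) c

theorem id_comp [Finite H] (b : RB R H G) :
    comp R (RBurnside.cls R (FinBiset.idBiset H)) b = b := by
  have : comp R (G := G) (RBurnside.cls R (FinBiset.idBiset H)) = LinearMap.id :=
    RBurnside.linearMap_ext fun V => by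
      rw [comp_cls]
      exact congrArg (RBurnside.ofMonoid R) (BurnsideMonoid.mk_eq (FinBiset.id_prod V))
  exact LinearMap.congr_fun this b

theorem comp_id [Finite H] (a : RB R K H) :
    comp R a (RBurnside.cls R (FinBiset.idBiset H)) = a := by
  have : (comp R (K := K)).flip (RBurnside.cls R (FinBiset.idBiset H)) = LinearMap.id :=
    RBurnside.linearMap_ext fun U => by
      rw [LinearMap.flip_apply, comp_cls]
      exact congrArg (RBurnside.ofMonoid R) (BurnsideMonoid.mk_eq (FinBiset.prod_id U))
  exact LinearMap.congr_fun this a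

theorem add_comp (a a' : RB R K H) (b : RB R H G) :
    comp R (a + a') b = comp R a b + comp R a' b := by
  rw [map_add, LinearMap.add_apply]

theorem comp_add (a : RB R K H) (b b' : RB R H G) :
    comp R a (b + b') = comp R a b + comp R a b' := map_add _ _ _

theorem smul_comp (r : R) (a : RB R K H) (b : RB R H G) :
    comp R (r • a) b = r • comp R a b := by
  rw [map_smul, LinearMap.smul_apply]

theorem comp_smul (r : R) (a : RB R K H) (b : RB R H G) :
    comp R a (r • b) = r • comp R a b := map_smul _ _ _

end Composition

/-- Objects of the biset category `RC` with coefficients in `R`: the finite groups. -/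
structure BisetCat (R : Type v) : Type (u + 1) where
  /-- The object of `RC` given by a finite group. -/
  of ::
  carrier : Type u
  [group : Group carrier]
  [finite : Finite carrier]

attribute [instance] BisetCat.group BisetCat.finite

namespace BisetCat

variable {R : Type v} [CommRing R]

/-- `Hom_{RC}(G, H) = RB(H, G)`; the composite of `f : G ⟶ H` and `g : H ⟶ K` is `g ×_H f`. -/
instance : Category.{max (u + 1) v} (BisetCat.{u} R) where
  Hom G H := RB R H.carrier G.carrier
  id G := RBurnside.cls R (FinBiset.idBiset G.carrier)
  comp f g := comp R g f
  id_comp f := comp_id R f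
  comp_id f := id_comp R f
  assoc f g h := (comp_assoc R h g f).symm

instance (G H : BisetCat.{u} R) : AddCommGroup (G ⟶ H) :=
  inferInstanceAs (AddCommGroup (RB R H.carrier G.carrier))

instance (G H : BisetCat.{u} R) : Module R (G ⟶ H) :=
  inferInstanceAs (Module R (RB R H.carrier G.carrier))

instance : Preadditive (BisetCat.{u} R) where
  add_comp _ _ _ f f' g := BisetFunctors.comp_add R g f f'
  comp_add _ _ _ f g g' := BisetFunctors.add_comp R g g' f

instance : Linear R (BisetCat.{u} R) where
  smul_comp _ _ _ r f g := BisetFunctors.comp_smul R r g f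
  comp_smul _ _ _ f r g := BisetFunctors.smul_comp R r g f

/-- An element of `RB(H, G)`, as a morphism from `G` to `H` in `RC`. -/
def hom {G H : Type u} [Group G] [Finite G] [Group H] [Finite H] (a : RB R H G) :
    (of (R := R) G) ⟶ (of (R := R) H) := a

end BisetCat

/-! ### Transitive bisets, restriction and deflation -/

/-- The transitive `X`-set `X / K`. -/
def cosetSet {X : Type u} [Group X] [Finite X] (K : Subgroup X) : FinGSet X where
  carrier := X ⧸ K

/-- The homomorphism `G × Hᵐᵒᵖ → G × H`, `(a, op b) ↦ (a, b⁻¹)`. -/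
def invSnd (G H : Type u) [Group G] [Group H] : G × Hᵐᵒᵖ →* G × H :=
  (MonoidHom.id G).prodMap (MulEquiv.inv' H).symm.toMonoidHom

theorem invSnd_apply {G H : Type u} [Group G] [Group H] (a : G) (b : H) :
    invSnd G H (a, op b) = (a, b⁻¹) := rfl

/-- The `(G, H)`-biset `(G × H) / L`, with `a · (g, h)L · b = (a g, b⁻¹ h)L`. -/
def cosetBiset {G H : Type u} [Group G] [Group H] [Finite G] [Finite H]
    (L : Subgroup (G × H)) : FinBiset G H where
  carrier := (G × H) ⧸ L
  action := MulAction.compHom _ (invSnd G H)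

/-- `Res_H^G`: the set `G`, as an `(H, G)`-biset. -/
def resBiset {G : Type u} [Group G] [Finite G] (H : Subgroup G) : FinBiset H G :=
  FinBiset.ofHoms H.subtype (MonoidHom.id G)

/-- `Def_{G/N}^G`: the set `G / N`, as a `(G / N, G)`-biset. -/
def defBiset {G : Type u} [Group G] [Finite G] (N : Subgroup G) [N.Normal] :
    FinBiset (G ⧸ N) G :=
  FinBiset.ofHoms (MonoidHom.id (G ⧸ N)) (QuotientGroup.mk' N)

/-! ### The ring homomorphism `α ↦ α~` and the idempotent `e_G^G` -/

/-- The `(G, G)`-biset `X~ = G × X`, with `a (g, x) b = (a g b, a x)`. -/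
def tildeSet {G : Type u} [Group G] [Finite G] (X : FinGSet G) : FinBiset G G where
  carrier := G × X.carrier
  action :=
    { smul := fun z p => (z.1 * p.1 * z.2.unop, z.1 • p.2)
      one_smul := fun p => Prod.ext
        (by change 1 * p.1 * 1 = p.1; simp) (one_smul G p.2)
      mul_smul := fun y z p => Prod.ext
        (by
          change y.1 * z.1 * p.1 * (z.2.unop * y.2.unop) =
            y.1 * (z.1 * p.1 * z.2.unop) * y.2.unop
          simp [mul_assoc])
        (mul_smul y.1 z.1 p.2) }

/-- The map `X ↦ X~` on isomorphism classes. -/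
def tildeMonoid (G : Type u) [Group G] [Finite G] :
    BurnsideMonoid G →+ BurnsideMonoid (G × Gᵐᵒᵖ) where
  toFun := Quotient.map tildeSet (by
    rintro A B ⟨e, he⟩
    exact ⟨Equiv.prodCongr (Equiv.refl G) e, fun z p => Prod.ext rfl (he z.1 p.2)⟩)
  map_zero' := BurnsideMonoid.mk_eq
    ⟨⟨fun p => p.2, fun p => p.elim, fun p => p.2.elim, fun p => p.elim⟩, fun _ p => p.2.elim⟩
  map_add' := by
    rintro ⟨A⟩ ⟨B⟩
    refine BurnsideMonoid.mk_eq ⟨Equiv.prodSumDistrib _ _ _, ?_⟩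
    rintro z ⟨g, (a | b)⟩ <;> rfl

/-- The map `RB(G) → RB(G, G)`, `α ↦ α~`. -/
def tilde (R : Type v) [CommRing R] (G : Type u) [Group G] [Finite G] :
    RBurnside R G →ₗ[R] RB R G G :=
  RBurnside.lift ((RBurnside.ofMonoid R).comp (tildeMonoid G))

open scoped Classical in
/-- The Möbius function of a finite poset. -/
def moebius {P : Type*} [PartialOrder P] [Finite P] (a b : P) : ℤ :=
  letI : Fintype P := Fintype.ofFinite P
  letI : LocallyFiniteOrder P := Fintype.toLocallyFiniteOrder
  IncidenceAlgebra.mu ℤ a b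

section Idempotents

variable (R : Type v) [CommRing R] (G : Type u) [Group G] [Finite G]

/-- `e_G^G = (1 / |G|) ∑_{K ≤ G} |K| μ(K, G) [G / K]` in `RB(G)`; here `|G|` is meant to be
invertible in `R`. -/
def topIdempotent : RBurnside R G :=
  Ring.inverse (Nat.card G : R) • ∑ᶠ K : Subgroup G,
    ((Nat.card K : R) * (moebius K ⊤ : R)) • RBurnside.cls R (cosetSet K)

variable {G}

/-- `Δ_N(G) = {(a, b) | a b⁻¹ ∈ N}`. -/
def diag (N : Subgroup G) [N.Normal] : Subgroup (G × G) where
  carrier := {p | p.1 * p.2⁻¹ ∈ N}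
  one_mem' := by simp
  mul_mem' := by
    rintro ⟨a, b⟩ ⟨c, d⟩ (h : a * b⁻¹ ∈ N) (h' : c * d⁻¹ ∈ N)
    change a * c * (b * d)⁻¹ ∈ N
    have : a * c * (b * d)⁻¹ = (a * (c * d⁻¹) * a⁻¹) * (a * b⁻¹) := by group
    rw [this]
    exact N.mul_mem (Subgroup.Normal.conj_mem inferInstance _ h' a) h
  inv_mem' := by
    rintro ⟨a, b⟩ (h : a * b⁻¹ ∈ N)
    change a⁻¹ * b⁻¹⁻¹ ∈ N
    have : a⁻¹ * b⁻¹⁻¹ = a⁻¹ * (a * b⁻¹)⁻¹ * a⁻¹⁻¹ := by group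
    rw [this]
    exact Subgroup.Normal.conj_mem inferInstance _ (N.inv_mem h) _

/-- `Y_L = e_G^G~ [(G × G) / L] e_G^G~` in `RB(G, G)`. -/
def Y (L : Subgroup (G × G)) : RB R G G :=
  comp R (comp R (tilde R G (topIdempotent R G)) (RBurnside.cls R (cosetBiset L)))
    (tilde R G (topIdempotent R G))

/-- The poset of normal subgroups of `G`. -/
abbrev NormalSubgroup (G : Type u) [Group G] : Type u := {N : Subgroup G // N.Normal}

instance (N : NormalSubgroup G) : N.1.Normal := N.2

/-- `φ_N^G`, the sum of `μ(N, M) Y_{Δ_M(G)}` over the normal subgroups `M` of `G` with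
`N ≤ M ≤ Φ(G)`, where `μ` is the Möbius function of the poset of normal subgroups of `G`. -/
def phi (N : NormalSubgroup G) : RB R G G :=
  ∑ᶠ (M : NormalSubgroup G) (_ : N ≤ M ∧ M.1 ≤ frattini G),
    (moebius N M : R) • Y R (diag M.1)

variable (G) in
/-- `φ_1^G`. -/
def phiOne : RB R G G := phi R (⟨⊥, inferInstance⟩ : NormalSubgroup G)

end Idempotents

/-! ### Biset functors -/

section Functors

variable {R : Type v} [CommRing R] (F : BisetCat.{u} R ⥤ ModuleCat.{w} R)
  (G : Type u) [Group G] [Finite G]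

/-- The `R`-linear map `F(a) : F(G) → F(H)` for `a ∈ RB(H, G)`. -/
def act {G H : Type u} [Group G] [Finite G] [Group H] [Finite H] (a : RB R H G) :
    F.obj (.of G) →ₗ[R] F.obj (.of H) :=
  (F.map (BisetCat.hom a)).hom

/-- `Res_H^G : F(G) → F(H)`. -/
def res {G : Type u} [Group G] [Finite G] (H : Subgroup G) :
    F.obj (.of G) →ₗ[R] F.obj (.of H) :=
  act F (RBurnside.cls R (resBiset H))

/-- `Def_{G/N}^G : F(G) → F(G / N)`. -/
def defl {G : Type u} [Group G] [Finite G] (N : Subgroup G) [N.Normal] :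
    F.obj (.of G) →ₗ[R] F.obj (.of (G ⧸ N)) :=
  act F (RBurnside.cls R (defBiset N))

/-- `δ_Φ F(G) = φ_1^G F(G)`. -/
def deltaPhi : Submodule R (F.obj (.of G)) :=
  LinearMap.range (act F (phiOne R G))

end Functors

end BisetFunctors

end

/-! Write `e` for the image of $e_G^G$ under `tilde`, and $\varphi$ for `phiOne`. The theorem
follows from two facts: the defining restrictions and deflations annihilate $\varphi$, and $\varphi$
fixes every $u$ that they annihilate. Idempotency of `e` or $\varphi$ is not needed.

Restriction: each $Y$ begins with `e`, and $\mathrm{Res}_H$ kills `e` for $H<G$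
(`res_comp_tilde_topIdempotent`). After multiplication by $|H|$, a finite $H$-set is described by
its stabilizers; those of $G/K$ are $H\cap gKg^{-1}$, and for fixed $g$ the sum over $K$ weighted by
$\mu(K,G)$ vanishes by the dual of Weisner's theorem.

Deflation: $\mu(K,G)=0$ unless $K\ge\Phi(G)$, so for $M\le\Phi(G)$ only sets $G/K$ inflated from
$G/M$ occur in `e`, and `e` commutes with $[(G\times G)/\Delta_M(G)]$
(`tilde_topIdempotent_comp_diag`). Since $\mathrm{Def}_{G/N}$ composed with that biset depends only
on $NM$ (`def_comp_diag`), Weisner's theorem for normal subgroups kills $\mathrm{Def}_{G/N}\varphi$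
when $1\ne N\le\Phi(G)$. The general case factors through $N\cap\Phi(G)$.

Conversely, let $u$ satisfy the vanishing conditions. The terms of `e` with $K<G$ factor through
$\mathrm{Res}_K$, so $eu=u$; the terms of $\varphi$ with $M\ne1$ factor through
$\mathrm{Def}_{G/M}$, so $\varphi u=u$. -/

noncomputable section

namespace BisetFunctors

/-! ### Möbius functions -/

section Moebius

variable {P : Type*} [PartialOrder P]

theorem sum_Iic_moebius [Finite P] [Fintype P] [DecidableLE P] [OrderBot P] (b : P) (hb : b ≠ ⊥) :
    ∑ x with x ≤ b, moebius ⊥ x = 0 := by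
  classical
  let : LocallyFiniteOrder P := Fintype.toLocallyFiniteOrder
  have h := IncidenceAlgebra.sum_Icc_mu_right (𝕜 := ℤ) (⊥ : P) b
  rw [if_neg hb.symm] at h
  rw [← h]
  unfold moebius
  -- `moebius` carries its own finiteness and order instances; `congr!` identifies them with the
  -- ambient ones.
  refine Finset.sum_congr (by ext; simp) fun x _ => ?_
  congr!

theorem sum_Ici_moebius [Finite P] [Fintype P] [DecidableLE P] [OrderTop P] (a : P) (ha : a ≠ ⊤) :
    ∑ x with a ≤ x, moebius x ⊤ = 0 := by
  classical
  let : LocallyFiniteOrder P := Fintype.toLocallyFiniteOrder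
  have h := IncidenceAlgebra.sum_Icc_mu_left (𝕜 := ℤ) a (⊤ : P)
  rw [if_neg ha] at h
  rw [← h]
  unfold moebius
  refine Finset.sum_congr (by ext; simp) fun x _ => ?_
  congr!

theorem moebius_self [Finite P] (a : P) : moebius a a = 1 := by
  classical
  let : Fintype P := Fintype.ofFinite P
  let : LocallyFiniteOrder P := Fintype.toLocallyFiniteOrder
  unfold moebius
  exact IncidenceAlgebra.mu_self _

/-- A form of Weisner's theorem: if the partial sums of `m` over the lower sets of the elements
above `a` vanish, then `m` is orthogonal to every function of `j x`, where `j x = x ⊔ a`. -/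
theorem sum_smul_comp_sup_eq_zero [Fintype P] [DecidableLE P] {V : Type*} [AddCommGroup V]
    (m : P → ℤ) (a : P) (j : P → P) (hj : ∀ x b, j x ≤ b ↔ x ≤ b ∧ a ≤ b)
    (hm : ∀ b, a ≤ b → ∑ x with x ≤ b, m x = 0) (f : P → V) :
    ∑ x, m x • f (j x) = 0 := by
  classical
  -- Every fibre of `j` has total weight zero. The total over `j x ≤ p` vanishes by `hm` if `a ≤ p`
  -- and is empty otherwise; by induction the fibres over `q < p` contribute nothing to it.
  have key : ∀ p : P, ∑ x with j x = p, m x = 0 := by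
    intro p
    induction p using WellFoundedLT.induction with
    | ind p ih =>
      have hsum : ∑ x with j x ≤ p, m x = 0 := by
        by_cases ha : a ≤ p
        · rw [← hm p ha]
          exact Finset.sum_congr (by ext; simp [hj, ha]) fun _ _ => rfl
        · exact Finset.sum_eq_zero fun x hx => absurd ((hj _ _).1 (Finset.mem_filter.1 hx).2).2 ha
      have hfib := Finset.sum_fiberwise_of_maps_to (s := {x | j x ≤ p})
        (t := ({q | q ≤ p} : Finset P)) (g := j) (by simp) m
      rw [hsum, Finset.sum_eq_single p] at hfib
      · rw [← hfib]
        exact Finset.sum_congr (by ext x; simp +contextual) fun _ _ => rfl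
      · intro q hq hqp
        rw [← ih q (lt_of_le_of_ne (Finset.mem_filter.1 hq).2 hqp)]
        refine Finset.sum_congr ?_ fun _ _ => rfl
        ext x
        have := (Finset.mem_filter.1 hq).2
        simp only [Finset.mem_filter, Finset.mem_univ, true_and]
        exact ⟨fun h => h.2, fun h => ⟨h ▸ this, h⟩⟩
      · simp
  rw [← Finset.sum_fiberwise (s := Finset.univ) (g := j)]
  refine Finset.sum_eq_zero fun p _ => ?_
  rw [Finset.sum_congr rfl fun x hx => by rw [(Finset.mem_filter.1 hx).2], ← Finset.sum_smul,
    key, zero_smul]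

/-- The order dual of the preceding result: if `b ≤ a ≠ ⊤`, then `b ≠ ⊤`, so the Möbius sum over the
elements above `b` vanishes. -/
theorem sum_moebius_top_smul_comp_inf {L : Type*} [Lattice L] [OrderTop L] [Fintype L]
    {V : Type*} [AddCommGroup V] (a : L) (ha : a ≠ ⊤) (f : L → V) :
    ∑ x, moebius x ⊤ • f (x ⊓ a) = 0 := by
  classical
  refine sum_smul_comp_sup_eq_zero (P := Lᵒᵈ) (fun x => moebius (OrderDual.ofDual x) ⊤)
    (OrderDual.toDual a) (fun x => x ⊔ OrderDual.toDual a) (fun x b => sup_le_iff) ?_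
    (fun x => f (OrderDual.ofDual x))
  intro b hb
  have hb' : OrderDual.ofDual b ≠ ⊤ := fun h => ha (top_le_iff.1 (h ▸ hb : (⊤ : L) ≤ a))
  exact sum_Ici_moebius (OrderDual.ofDual b) hb'

/-- Downward induction on `x`. Neither `x` nor `x ⊔ a` is `⊤`, so the Möbius sums above both vanish;
their difference runs over the `y ≥ x` not above `a`, where only `y = x` can remain. The intended
`a` is the Frattini subgroup, whose nongenerating property is `ha`. -/
theorem moebius_top_eq_zero {L : Type*} [Lattice L] [OrderTop L] [Finite L] (a : L)
    (ha : ∀ x : L, x ⊔ a = ⊤ → x = ⊤) (x : L) (hx : ¬ a ≤ x) : moebius x ⊤ = 0 := by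
  classical
  have := Fintype.ofFinite L
  induction x using WellFoundedGT.induction with
  | ind x ih =>
    have hxt : x ≠ ⊤ := fun h => hx (h ▸ le_top)
    have h1 := sum_Ici_moebius x hxt
    have h2 := sum_Ici_moebius (x ⊔ a) fun h => hxt (ha x h)
    rw [← Finset.sum_filter_add_sum_filter_not _ (fun y => a ≤ y), Finset.filter_filter,
      Finset.filter_filter] at h1
    simp only [sup_le_iff] at h2
    rw [h2, zero_add, Finset.sum_eq_single x] at h1
    · exact h1
    · intro y hy hyx
      simp only [Finset.mem_filter, Finset.mem_univ, true_and] at hy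
      exact ih y (lt_of_le_of_ne hy.1 (Ne.symm hyx)) hy.2
    · intro h
      simp [hx] at h

end Moebius

/-! ### Transitive decomposition of finite `X`-sets -/

section Sets

variable {X Y : Type u} [Group X] [Group Y]

theorem FinGSet.Iso.of_bijective {A B : FinGSet X} (f : A.carrier → B.carrier)
    (hf : Function.Bijective f) (h : ∀ (x : X) a, f (x • a) = x • f a) : A.Iso B :=
  ⟨Equiv.ofBijective f hf, h⟩

/-- The stable subset `s` of an `X`-set. -/
def FinGSet.restrictTo (A : FinGSet X) (s : Set A.carrier) (hs : ∀ (x : X), ∀ a ∈ s, x • a ∈ s) :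
    FinGSet X where
  carrier := s
  action :=
    { smul := fun x a => ⟨x • a.1, hs x a.1 a.2⟩
      one_smul := fun a => Subtype.ext (one_smul X a.1)
      mul_smul := fun x y a => Subtype.ext (mul_smul x y a.1) }

/-- The `X`-set obtained from a `Y`-set along `f : X →* Y`. -/
def FinGSet.comap (f : X →* Y) (A : FinGSet Y) : FinGSet X where
  carrier := A.carrier
  action := MulAction.compHom _ f

theorem FinGSet.restrictTo_sum_compl (A : FinGSet X) (s : Set A.carrier)
    (hs : ∀ (x : X), ∀ a ∈ s, x • a ∈ s) (hs' : ∀ (x : X), ∀ a ∈ sᶜ, x • a ∈ sᶜ) :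
    ((A.restrictTo s hs).sum (A.restrictTo sᶜ hs')).Iso A := by
  classical
  refine ⟨Equiv.Set.sumCompl s, ?_⟩
  rintro x (a | a) <;> rfl

/-- If `X` is transitive on `A`, then `A` is `X` modulo a stabilizer. -/
theorem cosetSet_stabilizer_iso [Finite X] (A : FinGSet X) [MulAction.IsPretransitive X A.carrier]
    (a : A.carrier) : (cosetSet (MulAction.stabilizer X a)).Iso A := by
  refine .of_bijective (MulAction.ofQuotientStabilizer X a)
    ⟨MulAction.injective_ofQuotientStabilizer X a, fun b => ?_⟩
    fun x b => MulAction.ofQuotientStabilizer_smul X a x b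
  obtain ⟨x, rfl⟩ := MulAction.exists_smul_eq X a b
  exact ⟨(x : X ⧸ _), rfl⟩

/-- Strong induction on the cardinality: split off the orbit of a point, which leaves a smaller
stable complement. -/
theorem BurnsideMonoid.hom_ext_coset [Finite X] {V : Type*} [AddCommMonoid V]
    {f g : BurnsideMonoid X →+ V}
    (h : ∀ A : FinGSet X, MulAction.IsPretransitive X A.carrier → f (mk A) = g (mk A)) : f = g := by
  have main : ∀ (n : ℕ) (A : FinGSet X), Nat.card A.carrier = n → f (mk A) = g (mk A) := by
    intro n
    induction n using Nat.strong_induction_on with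
    | _ n ih =>
      intro A hA
      rcases isEmpty_or_nonempty A.carrier with he | ⟨⟨a⟩⟩
      · have : mk A = 0 := mk_eq ⟨Equiv.equivOfIsEmpty _ _, fun _ a => he.elim a⟩
        rw [this, map_zero, map_zero]
      · have hs : ∀ (x : X), ∀ b ∈ MulAction.orbit X a, x • b ∈ MulAction.orbit X a :=
          fun x b ⟨y, hy⟩ => ⟨x * y, by rw [← hy]; exact mul_smul x y a⟩
        have hs' : ∀ (x : X), ∀ b ∈ (MulAction.orbit X a)ᶜ, x • b ∈ (MulAction.orbit X a)ᶜ :=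
          fun x b hb hb' => hb (by simpa using hs x⁻¹ _ hb')
        rw [← mk_eq (A.restrictTo_sum_compl _ hs hs'), mk_sum, map_add, map_add]
        congr 1
        · refine h _ ⟨?_⟩
          rintro ⟨_, x, rfl⟩ ⟨_, y, rfl⟩
          exact ⟨y * x⁻¹, Subtype.ext (by
            change (y * x⁻¹) • x • a = y • a
            rw [smul_smul, inv_mul_cancel_right])⟩
        · refine ih _ ?_ _ rfl
          rw [← hA]
          change Nat.card ((MulAction.orbit X a)ᶜ : Set A.carrier) < _
          rw [Nat.card_coe_set_eq, ← Set.ncard_univ]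
          exact Set.ncard_lt_ncard ((Set.ssubset_univ_iff).2 fun h =>
            (h ▸ Set.mem_univ a : a ∈ (MulAction.orbit X a)ᶜ) (MulAction.mem_orbit_self a))
  ext ⟨A⟩
  exact main _ A rfl

/-- The additive function `A ↦ ∑_{a ∈ A} F (X_a)` on isomorphism classes of finite `X`-sets. -/
def stabilizerSum {V : Type*} [AddCommMonoid V] (F : Subgroup X → V) : BurnsideMonoid X →+ V where
  toFun := Quotient.lift (fun A => ∑ᶠ a : A.carrier, F (MulAction.stabilizer X a)) (by
    rintro A B ⟨e, he⟩
    refine finsum_eq_of_bijective e e.bijective fun a => congrArg F ?_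
    ext x
    rw [MulAction.mem_stabilizer_iff, MulAction.mem_stabilizer_iff, ← he, e.apply_eq_iff_eq])
  map_zero' := finsum_of_isEmpty (α := (FinGSet.empty X).carrier) _
  map_add' := by
    rintro ⟨A⟩ ⟨B⟩
    have := Fintype.ofFinite A.carrier
    have := Fintype.ofFinite B.carrier
    change ∑ᶠ c : A.carrier ⊕ B.carrier, F (MulAction.stabilizer X
      (show (A.sum B).carrier from c)) = (∑ᶠ a, _) + ∑ᶠ b, _
    rw [finsum_eq_sum_of_fintype, finsum_eq_sum_of_fintype, finsum_eq_sum_of_fintype,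
      Fintype.sum_sum_type]
    congr 1 <;> refine Finset.sum_congr rfl fun a _ => congrArg F ?_ <;> ext x
    · exact Sum.inl_injective.eq_iff
    · exact Sum.inr_injective.eq_iff

theorem stabilizerSum_mk {V : Type*} [AddCommMonoid V] (F : Subgroup X → V) (A : FinGSet X) :
    stabilizerSum F (BurnsideMonoid.mk A) = ∑ᶠ a : A.carrier, F (MulAction.stabilizer X a) := rfl

/-- On a transitive set $A$ all stabilizers have the same order and each $X/X_b$ is isomorphic to
$A$, so orbit–stabilizer gives the total $|X|[A]$. An additive map is thereby expressed through
stabilizers, up to the factor $|X|$. -/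
theorem stabilizerSum_card_smul_coset [Finite X] (a : BurnsideMonoid X) :
    stabilizerSum (fun K : Subgroup X => Nat.card K • BurnsideMonoid.mk (cosetSet K)) a =
      Nat.card X • a := by
  have : stabilizerSum (fun K : Subgroup X => Nat.card K • BurnsideMonoid.mk (cosetSet K)) =
      Nat.card X • AddMonoidHom.id _ := by
    refine BurnsideMonoid.hom_ext_coset fun A hA => ?_
    rw [stabilizerSum_mk]
    have := Fintype.ofFinite A.carrier
    -- `IsPretransitive` also holds for the empty set.
    rcases isEmpty_or_nonempty A.carrier with he | ⟨⟨a⟩⟩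
    · have : BurnsideMonoid.mk A = 0 :=
        BurnsideMonoid.mk_eq ⟨Equiv.equivOfIsEmpty _ _, fun _ a => he.elim a⟩
      rw [this, map_zero, finsum_of_isEmpty]
    · have hc : ∀ b : A.carrier, Nat.card (MulAction.stabilizer X b) =
          Nat.card (MulAction.stabilizer X a) := by
        intro b
        obtain ⟨x, rfl⟩ := MulAction.exists_smul_eq X a b
        exact Nat.card_congr (MulAction.stabilizerEquivStabilizer rfl).toEquiv.symm
      simp only [fun b => BurnsideMonoid.mk_eq (cosetSet_stabilizer_iso A b), hc,
        finsum_eq_sum_of_fintype, Finset.sum_const, smul_smul, Finset.card_univ]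
      rw [← Nat.card_eq_fintype_card, ← MulAction.index_stabilizer_of_transitive X a, mul_comm,
        Subgroup.card_mul_index]
      rfl
  exact DFunLike.congr_fun this a

end Sets

/-! ### Isomorphisms of bisets -/

namespace FinBiset

variable {K H G J T S Q : Type u} [Group K] [Group H] [Group G] [Group J] [Group T] [Group S]
  [Group Q]

theorem prodMk_eq {U : FinBiset K H} {V : FinBiset H G} {u u' : U.carrier} {v v' : V.carrier}
    (h : H) (hu : ((1, op h) : K × Hᵐᵒᵖ) • u = u') (hv : ((h⁻¹, 1) : H × Gᵐᵒᵖ) • v = v') :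
    prodMk U V u v = prodMk U V u' v' := Quotient.sound ⟨h, hu, hv⟩

/-- The composition of two bisets given by homomorphisms, when `H` surjects onto the fibre product
of `T` and `S` over `Q`. -/
theorem prod_ofHoms_iso [Finite T] [Finite S] [Finite Q] (α : K →* T) (β : H →* T) (γ : H →* S)
    (δ : G →* S) (p : T →* Q) (q : S →* Q) (hcomm : ∀ h, p (β h) = q (γ h))
    (hsurj : ∀ x, ∃ t s, p t * q s = x)
    (hpull : ∀ t s, p t = q s → ∃ h, β h = t ∧ γ h = s) :
    (prod (ofHoms α β) (ofHoms γ δ)).Iso (ofHoms (p.comp α) (q.comp δ)) := by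
  refine .of_bijective (prodLift (fun (t : T) (s : S) => p t * q s) ?_) ⟨?_, fun x => ?_⟩ ?_
  · intro h (t : T) (s : S)
    change p (α 1 * t * β h) * q s = p t * q (γ h * s * δ 1)
    simp [hcomm, mul_assoc]
  · refine prod_ind fun (t : T) (s : S) => prod_ind fun (t' : T) (s' : S) hts => ?_
    replace hts : p t * q s = p t' * q s' := hts
    obtain ⟨h, h1, h2⟩ := hpull (t⁻¹ * t') (s * s'⁻¹) (by
      rw [map_mul, map_mul, map_inv, map_inv, inv_mul_eq_iff_eq_mul, ← mul_assoc, hts,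
        mul_inv_cancel_right])
    refine prodMk_eq h ?_ ?_
    · change α 1 * t * β h = t'
      simp [h1]
    · change γ h⁻¹ * s * δ 1 = s'
      simp [h2]
  · obtain ⟨t, s, rfl⟩ := hsurj x
    exact ⟨prodMk (ofHoms α β) (ofHoms γ δ) t s, rfl⟩
  · intro x
    refine prod_ind fun (t : T) (s : S) => ?_
    change p (α x.1 * t * β 1) * q (γ 1 * s * δ x.2.unop) =
      p (α x.1) * (p t * q s) * q (δ x.2.unop)
    simp [mul_assoc]

/-- The biset `U × X`, with `k (u, x) g = (k u g, k x)`. -/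
def twist (U : FinBiset K G) (X : FinGSet K) : FinBiset K G where
  carrier := U.carrier × X.carrier
  action :=
    { smul := fun z p => (z • p.1, z.1 • p.2)
      one_smul := fun p => Prod.ext (one_smul _ p.1) (one_smul K p.2)
      mul_smul := fun y z p => Prod.ext (mul_smul y z p.1) (mul_smul y.1 z.1 p.2) }

/-- The additive map `X ↦ U × X` on isomorphism classes. -/
def twistMonoid (U : FinBiset K G) : BurnsideMonoid K →+ BurnsideMonoid (K × Gᵐᵒᵖ) where
  toFun := Quotient.map (twist U) (by
    rintro A B ⟨e, he⟩
    exact ⟨Equiv.prodCongr (Equiv.refl _) e, fun z p => Prod.ext rfl (he z.1 p.2)⟩)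
  map_zero' := BurnsideMonoid.mk_eq
    ⟨⟨fun p => p.2, fun p => p.elim, fun p => p.2.elim, fun p => p.elim⟩, fun _ p => p.2.elim⟩
  map_add' := by
    rintro ⟨A⟩ ⟨B⟩
    refine BurnsideMonoid.mk_eq ⟨Equiv.prodSumDistrib _ _ _, ?_⟩
    rintro z ⟨g, (a | b)⟩ <;> rfl

theorem twist_congr (U : FinBiset K G) {X Y : FinGSet K} (h : X.Iso Y) :
    (twist U X).Iso (twist U Y) := by
  obtain ⟨e, he⟩ := h
  exact ⟨Equiv.prodCongr (Equiv.refl _) e, fun z p => Prod.ext rfl (he z.1 p.2)⟩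

theorem tildeSet_congr [Finite G] {X Y : FinGSet G} (h : X.Iso Y) :
    (tildeSet X).Iso (tildeSet Y) := by
  obtain ⟨e, he⟩ := h
  exact ⟨Equiv.prodCongr (Equiv.refl _) e, fun z p => Prod.ext rfl (he z.1 p.2)⟩

/-- The group coordinate can be moved across the balanced product into $U$, leaving $X$ as a factor.
-/
theorem tildeSet_prod_iso [Finite H] (X : FinGSet H) (U : FinBiset H G) :
    (prod (tildeSet X) U).Iso (twist U X) := by
  refine .of_bijective
    (prodLift (fun (p : H × X.carrier) u => (((p.1, 1) : H × Gᵐᵒᵖ) • u, p.2)) ?_)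
    ⟨?_, fun p => ⟨prodMk (tildeSet X) U ((1 : H), p.2) p.1, Prod.ext (one_smul _ p.1) rfl⟩⟩ ?_
  · rintro h ⟨k, x⟩ u
    change (((1 * k * h : H), 1) • u, (1 : H) • x) = ((k, 1) • ((h, 1) : H × Gᵐᵒᵖ) • u, x)
    simp [smul_smul]
  · refine prod_ind fun ⟨k, x⟩ u => prod_ind fun ⟨k', x'⟩ u' h => ?_
    obtain ⟨h1, rfl⟩ := Prod.mk.inj h
    refine prodMk_eq (k⁻¹ * k') ?_ ?_
    · change ((1 * k * (k⁻¹ * k') : H), (1 : H) • x) = (k', x)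
      simp
    · have : u' = ((k', 1) : H × Gᵐᵒᵖ)⁻¹ • ((k, 1) : H × Gᵐᵒᵖ) • u := eq_inv_smul_iff.2 h1.symm
      rw [this, smul_smul]
      simp
  · intro z
    refine prod_ind fun ⟨k, x⟩ u => ?_
    change (((z.1 * k * 1 : H), 1) • ((1, z.2) : H × Gᵐᵒᵖ) • u, z.1 • x) =
      (z • ((k, 1) : H × Gᵐᵒᵖ) • u, z.1 • x)
    obtain ⟨a, b⟩ := z
    simp [smul_smul]

/-- A $T$-set slides across the biset $T$: its pullback along `β` on the right becomes its pullback
along `α` on the left, because $t$ itself acts on $X$. With $T=G$ this computes the restriction of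
`e`; with $T=G/M$ it gives the commutation with $G/M$. -/
theorem ofHoms_prod_tildeSet_iso [Finite T] [Finite H] (α : K →* T) (β : H →* T) (X : FinGSet T) :
    (prod (ofHoms α β) (tildeSet (X.comap β))).Iso (twist (ofHoms α β) (X.comap α)) := by
  refine .of_bijective
    (prodLift (fun (t : T) (p : H × X.carrier) => ((t * β p.1 : T), t • p.2)) ?_)
    ⟨?_, fun ⟨(t : T), (x : X.carrier)⟩ =>
      ⟨prodMk (ofHoms α β) (tildeSet (X.comap β)) t ((1 : H), (t⁻¹ • x : X.carrier)), ?_⟩⟩ ?_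
  · rintro h (t : T) ⟨k, x⟩
    change ((α 1 * t * β h * β k : T), (α 1 * t * β h) • (show X.carrier from x)) =
      ((t * β (h * k * 1) : T), t • β h • (show X.carrier from x))
    rw [smul_smul]
    simp [mul_assoc]
  · refine prod_ind fun (t : T) ⟨k, x⟩ => prod_ind fun (t' : T) ⟨k', x'⟩ h => ?_
    obtain ⟨h1, h2⟩ := Prod.mk.inj h
    change t * β k = t' * β k' at h1
    change t • (show X.carrier from x) = t' • (show X.carrier from x') at h2
    have h3 : β k * (β k')⁻¹ = t⁻¹ * t' := by
      rw [mul_inv_eq_iff_eq_mul, mul_assoc, ← h1, inv_mul_cancel_left]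
    refine prodMk_eq (k * k'⁻¹) ?_ (Prod.ext ?_ ?_)
    · change α 1 * t * β (k * k'⁻¹) = t'
      simp [h3]
    · change (k * k'⁻¹)⁻¹ * k * 1 = k'
      simp
    · change β (k * k'⁻¹)⁻¹ • (show X.carrier from x) = x'
      rw [map_inv, map_mul, map_inv, h3, mul_inv_rev, inv_inv, mul_smul, h2, inv_smul_smul]
  · exact Prod.ext (by change t * β 1 = t; simp) (smul_inv_smul t x)
  · intro z
    refine prod_ind fun (t : T) ⟨k, x⟩ => ?_
    change (((α z.1 * t * β 1) * β (1 * k * z.2.unop) : T),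
        (α z.1 * t * β 1) • β 1 • (show X.carrier from x)) =
      ((α z.1 * (t * β k) * β z.2.unop : T), α z.1 • t • (show X.carrier from x))
    rw [smul_smul, smul_smul]
    simp [mul_assoc]

/-- `[G / L]~` factors through restriction to `L`. -/
theorem ind_prod_res_iso [Finite G] (L : Subgroup G) :
    (prod (ofHoms (MonoidHom.id G) L.subtype) (resBiset L)).Iso (tildeSet (cosetSet L)) := by
  refine .of_bijective (prodLift (fun (s t : G) => ((s * t : G), (s : G ⧸ L))) ?_)
    ⟨?_, fun ⟨(t : G), (x : G ⧸ L)⟩ => ?_⟩ ?_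
  · rintro h (s : G) (t : G)
    change (((1 * s * h * t : G), ((1 * s * h : G) : G ⧸ L)) : G × G ⧸ L) =
      ((s * (h * t * 1) : G), (s : G ⧸ L))
    refine Prod.ext (by simp [mul_assoc]) ?_
    rw [one_mul]
    exact QuotientGroup.mk_mul_of_mem s h.2
  · refine prod_ind fun (s : G) (t : G) => prod_ind fun (s' : G) (t' : G) h => ?_
    obtain ⟨h1, h2⟩ := Prod.mk.inj h
    refine prodMk_eq (⟨s⁻¹ * s', QuotientGroup.eq.1 h2⟩ : L) ?_ ?_
    · change 1 * s * (s⁻¹ * s') = s'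
      simp
    · change (s⁻¹ * s')⁻¹ * t * 1 = t'
      replace h1 : s * t = s' * t' := h1
      rw [mul_one, mul_inv_rev, inv_inv, mul_assoc, h1, inv_mul_cancel_left]
  · obtain ⟨s, rfl⟩ := QuotientGroup.mk_surjective x
    exact ⟨prodMk (ofHoms (MonoidHom.id G) L.subtype) (resBiset L) s (s⁻¹ * t : G),
      Prod.ext (mul_inv_cancel_left s t) rfl⟩
  · intro z
    refine prod_ind fun (s : G) (t : G) => ?_
    change (((z.1 * s * 1) * (1 * t * z.2.unop) : G), ((z.1 * s * 1 : G) : G ⧸ L)) =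
      ((z.1 * (s * t) * z.2.unop : G), ((z.1 * s : G) : G ⧸ L))
    simp [mul_assoc]

theorem tildeSet_coset_top_iso [Finite G] :
    (tildeSet (cosetSet (⊤ : Subgroup G))).Iso (idBiset G) := by
  refine .of_bijective (fun p => p.1) ⟨?_, fun t => ⟨(t, ((1 : G) : G ⧸ (⊤ : Subgroup G))), rfl⟩⟩
    fun z p => rfl
  rintro ⟨t, x⟩ ⟨t', x'⟩ (rfl : t = t')
  exact Prod.ext rfl (QuotientGroup.subsingleton_quotient_top.elim x x')

theorem ofHoms_congr_iso [Finite T] [Finite S] (e : T ≃* S) (α : G →* T) (β : H →* T) :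
    (ofHoms α β).Iso (ofHoms (e.toMonoidHom.comp α) (e.toMonoidHom.comp β)) :=
  ⟨e.toEquiv, fun x (t : T) => by
    change e (α x.1 * t * β x.2.unop) = e (α x.1) * e t * e (β x.2.unop)
    simp⟩

/-- `(G × G) / Δ_M(G)` is the set `G / M`. -/
theorem cosetBiset_diag_iso [Finite G] (M : Subgroup G) [M.Normal] :
    (cosetBiset (diag M)).Iso (ofHoms (QuotientGroup.mk' M) (QuotientGroup.mk' M)) := by
  -- The two directions are the injectivity and the well-definedness of $(a,b)\mapsto ab^{-1}M$ on
  -- cosets of $\Delta_M(G)$.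
  have hdiv : ∀ a b c d : G, ((a * b⁻¹ : G) : G ⧸ M) = ((c * d⁻¹ : G) : G ⧸ M) ↔
      (a, b)⁻¹ * (c, d) ∈ diag M := by
    intro a b c d
    change _ ↔ a⁻¹ * c * (b⁻¹ * d)⁻¹ ∈ M
    rw [QuotientGroup.eq, ← Subgroup.Normal.mem_comm_iff inferInstance]
    have h1 : c * d⁻¹ * (a * b⁻¹)⁻¹ = a * (a⁻¹ * c * (b⁻¹ * d)⁻¹) * a⁻¹ := by group
    rw [h1]
    exact ⟨fun h => by simpa [mul_assoc] using Subgroup.Normal.conj_mem inferInstance _ h a⁻¹,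
      fun h => Subgroup.Normal.conj_mem inferInstance _ h a⟩
  refine .of_bijective (A := cosetBiset (diag M)) (fun x : (G × G) ⧸ diag M =>
      Quotient.liftOn' x (fun p => ((p.1 * p.2⁻¹ : G) : G ⧸ M)) ?_) ⟨?_, ?_⟩ ?_
  · rintro ⟨a, b⟩ ⟨c, d⟩ h
    exact (hdiv a b c d).2 (QuotientGroup.leftRel_apply.1 h)
  · rintro ⟨a, b⟩ ⟨c, d⟩ h
    exact QuotientGroup.eq.2 ((hdiv a b c d).1 h)
  · rintro ⟨a⟩
    exact ⟨(((a, 1) : G × G) : (G × G) ⧸ diag M), by change ((a * 1⁻¹ : G) : G ⧸ M) = _; simp; rfl⟩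
  · rintro z ⟨a, b⟩
    change ((z.1 * a * (z.2.unop⁻¹ * b)⁻¹ : G) : G ⧸ M) =
      (z.1 : G ⧸ M) * ((a * b⁻¹ : G) : G ⧸ M) * (z.2.unop : G ⧸ M)
    simp [mul_assoc]

end FinBiset

/-- A `G`-set on which the normal subgroup `M` acts trivially, as a `G / M`-set. -/
def FinGSet.ofQuotient {G : Type u} [Group G] (M : Subgroup G) [M.Normal] (A : FinGSet G)
    (h : M ≤ (MulAction.toPermHom G A.carrier).ker) : FinGSet (G ⧸ M) where
  carrier := A.carrier
  action := MulAction.compHom _ (QuotientGroup.lift M (MulAction.toPermHom G A.carrier) h)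

theorem FinGSet.comap_ofQuotient_iso {G : Type u} [Group G] (M : Subgroup G) [M.Normal]
    (A : FinGSet G) (h : M ≤ (MulAction.toPermHom G A.carrier).ker) :
    A.Iso ((FinGSet.ofQuotient M A h).comap (QuotientGroup.mk' M)) :=
  ⟨Equiv.refl _, fun _ _ => rfl⟩

theorem le_ker_toPermHom_cosetSet {G : Type u} [Group G] [Finite G] {M K : Subgroup G} [M.Normal]
    (h : M ≤ K) : M ≤ (MulAction.toPermHom G (cosetSet K).carrier).ker := by
  intro m hm
  refine Equiv.ext ?_
  rintro ⟨g⟩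
  change ((m * g : G) : G ⧸ K) = (g : G ⧸ K)
  refine (QuotientGroup.eq.2 (h ?_)).symm
  rw [← mul_assoc]
  simpa using Subgroup.Normal.conj_mem inferInstance m hm g⁻¹

/-! ### Restriction of the idempotent `e_G^G` -/

theorem sum_quotient_mk {G : Type*} [Group G] [Fintype G] (K : Subgroup G) [Fintype (G ⧸ K)]
    {V : Type*} [AddCommMonoid V] (f : G ⧸ K → V) :
    ∑ g : G, f g = Nat.card K • ∑ x, f x := by
  classical
  rw [← Finset.sum_fiberwise (s := Finset.univ) (g := fun g : G => (g : G ⧸ K)), Finset.smul_sum]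
  refine Finset.sum_congr rfl fun x _ => ?_
  rw [Finset.sum_congr rfl fun g hg => by rw [(Finset.mem_filter.1 hg).2], Finset.sum_const]
  congr 1
  rw [← Fintype.card_subtype, ← Nat.card_eq_fintype_card]
  have := QuotientGroup.card_preimage_mk K {x}
  rwa [Nat.card_coe_set_eq {x}, Set.ncard_singleton, mul_one] at this

/-- The stabilizer of $gK$ consists of the $h$ with $g^{-1}i(h)g\in K$. Summing over $g$ instead of
cosets costs the factor $|K|$ and makes the index set independent of $K$, so that sums over $g$ and
$K$ can be exchanged. -/
theorem stabilizerSum_comap_cosetSet {G H : Type u} [Group G] [Group H] [Finite G] [Fintype G]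
    (K : Subgroup G) (i : H →* G) {V : Type*} [AddCommMonoid V] (f : Subgroup H → V) :
    Nat.card K • stabilizerSum f (BurnsideMonoid.mk ((cosetSet K).comap i)) =
      ∑ g : G, f (K.comap ((MulAut.conj g⁻¹).toMonoidHom.comp i)) := by
  have := Fintype.ofFinite (G ⧸ K)
  change Nat.card K • ∑ᶠ x : G ⧸ K, f (MulAction.stabilizer H
    (show ((cosetSet K).comap i).carrier from x)) = _
  rw [finsum_eq_sum_of_fintype, ← sum_quotient_mk]
  refine Finset.sum_congr rfl fun g _ => congrArg f ?_
  ext h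
  change ((i h * g : G) : G ⧸ K) = (g : G ⧸ K) ↔ g⁻¹ * i h * g⁻¹⁻¹ ∈ K
  rw [eq_comm, QuotientGroup.eq, inv_inv, mul_assoc]

theorem sum_card_mul_moebius_comap_eq_zero {G : Type u} [Group G] [Finite G]
    [Fintype (Subgroup G)] {H : Subgroup G} (hH : H ≠ ⊤) {R : Type v} [CommRing R]
    (hu : IsUnit (Nat.card H : R)) {V : Type*} [AddCommGroup V] [Module R V]
    (Ψ : BurnsideMonoid H →+ V) :
    ∑ K : Subgroup G, ((Nat.card K : R) * (moebius K ⊤ : R)) •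
      Ψ (BurnsideMonoid.mk ((cosetSet K).comap H.subtype)) = 0 := by
  have := Fintype.ofFinite G
  -- The factor $|H|$, harmless since it is a unit, allows the passage to stabilizers.
  rw [← hu.smul_eq_zero, Finset.smul_sum]
  let F : Subgroup H → V := fun L => Nat.card L • Ψ (BurnsideMonoid.mk (cosetSet L))
  have hΨ : ∀ a, Nat.card H • Ψ a = stabilizerSum F a := by
    intro a
    rw [← map_nsmul, ← stabilizerSum_card_smul_coset]
    obtain ⟨A⟩ := a
    change Ψ (stabilizerSum _ (BurnsideMonoid.mk A)) = stabilizerSum _ (BurnsideMonoid.mk A)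
    have := Fintype.ofFinite A.carrier
    rw [stabilizerSum_mk, stabilizerSum_mk, finsum_eq_sum_of_fintype, finsum_eq_sum_of_fintype,
      map_sum]
    exact Finset.sum_congr rfl fun x _ => map_nsmul _ _ _
  have hterm : ∀ K : Subgroup G, (Nat.card H : R) • ((Nat.card K : R) * (moebius K ⊤ : R)) •
      Ψ (BurnsideMonoid.mk ((cosetSet K).comap H.subtype)) =
      ∑ g : G, moebius K ⊤ • F (K.comap ((MulAut.conj g⁻¹).toMonoidHom.comp H.subtype)) := by
    intro K
    rw [← Finset.smul_sum, ← stabilizerSum_comap_cosetSet, ← hΨ]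
    simp only [← Nat.cast_smul_eq_nsmul R, ← Int.cast_smul_eq_zsmul R, smul_smul]
    congr 1
    ring
  rw [Finset.sum_congr rfl fun K _ => hterm K, Finset.sum_comm]
  refine Finset.sum_eq_zero fun g _ => ?_
  -- For fixed `g`, the pullback of `K` along `c` depends only on `K ⊓ c.range`, and `c.range`, a
  -- conjugate of `H`, is proper.
  let c : H →* G := (MulAut.conj g⁻¹).toMonoidHom.comp H.subtype
  have hc : c.range ≠ ⊤ := by
    intro h
    apply hH
    apply Subgroup.eq_top_of_card_eq
    rw [← Nat.card_congr (Subgroup.topEquiv (G := G)).toEquiv, ← h]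
    exact Nat.card_congr (MonoidHom.ofInjective
      ((MulAut.conj g⁻¹).injective.comp H.subtype_injective)).toEquiv
  rw [← sum_moebius_top_smul_comp_inf c.range hc (fun K => F (K.comap c))]
  refine Finset.sum_congr rfl fun K _ => ?_
  congr 2
  ext h
  simp [c]

section

variable {R : Type v} [CommRing R] {G : Type u} [Group G] [Finite G]

theorem RBurnside.cls_eq {X : Type u} [Group X] {A B : FinGSet X} (h : A.Iso B) :
    cls R A = cls R B := congrArg (ofMonoid R) (BurnsideMonoid.mk_eq h)

theorem tilde_cls (X : FinGSet G) :
    tilde R G (RBurnside.cls R X) = RBurnside.cls R (tildeSet X) := RBurnside.lift_cls _ X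

theorem tilde_topIdempotent [Fintype (Subgroup G)] :
    tilde R G (topIdempotent R G) = Ring.inverse (Nat.card G : R) • ∑ K : Subgroup G,
      ((Nat.card K : R) * (moebius K ⊤ : R)) • RBurnside.cls R (tildeSet (cosetSet K)) := by
  rw [topIdempotent, finsum_eq_sum_of_fintype]
  simp only [map_smul, map_sum, tilde_cls]

/-- `Res_H^G e_G^G = 0` for proper subgroups `H`. -/
theorem res_comp_tilde_topIdempotent (hG : IsUnit (Nat.card G : R)) {H : Subgroup G}
    (hH : H ≠ ⊤) :
    comp R (RBurnside.cls R (resBiset H)) (tilde R G (topIdempotent R G)) = 0 := by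
  have := Fintype.ofFinite (Subgroup G)
  have hu : IsUnit (Nat.card H : R) := isUnit_of_dvd_unit
    (Nat.cast_dvd_cast H.card_subgroup_dvd_card) hG
  rw [tilde_topIdempotent, map_smul, map_sum]
  simp only [map_smul, comp_cls]
  -- The term of $K$ is the restriction biset twisted by $\mathrm{Res}_H(G/K)$, which is additive in
  -- that $H$-set.
  rw [← smul_zero (Ring.inverse (Nat.card G : R)), ← sum_card_mul_moebius_comap_eq_zero hH hu
    ((RBurnside.ofMonoid R).comp (FinBiset.twistMonoid (resBiset H)))]
  congr 1
  refine Finset.sum_congr rfl fun K _ => congrArg _ ?_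
  refine RBurnside.cls_eq (FinGSet.Iso.equivalence _ |>.trans ?_
    (FinBiset.ofHoms_prod_tildeSet_iso H.subtype (MonoidHom.id G) (cosetSet K)))
  exact FinBiset.prod_congr ((FinGSet.Iso.equivalence _).refl _)
    (FinBiset.tildeSet_congr ⟨Equiv.refl _, fun _ _ => rfl⟩)

/-- Only the $K\ge\Phi(G)\ge M$ have a nonzero coefficient. For these, $M$ acts trivially on $G/K$,
which is thus a $G/M$-set and slides across the biset $G/M$. -/
theorem tilde_topIdempotent_comp_diag (M : Subgroup G) [M.Normal] (hM : M ≤ frattini G) :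
    comp R (tilde R G (topIdempotent R G)) (RBurnside.cls R (cosetBiset (diag M))) =
      comp R (RBurnside.cls R (cosetBiset (diag M))) (tilde R G (topIdempotent R G)) := by
  have := Fintype.ofFinite (Subgroup G)
  rw [tilde_topIdempotent, map_smul, map_smul, map_sum, map_sum, LinearMap.smul_apply,
    LinearMap.sum_apply]
  congr 1
  refine Finset.sum_congr rfl fun K _ => ?_
  rw [map_smul, map_smul, LinearMap.smul_apply]
  by_cases hK : frattini G ≤ K
  · congr 1
    rw [comp_cls, comp_cls]
    have h1 := FinBiset.cosetBiset_diag_iso M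
    have h2 := FinGSet.comap_ofQuotient_iso M (cosetSet K)
      (le_ker_toPermHom_cosetSet (hM.trans hK))
    have h3 := FinBiset.ofHoms_prod_tildeSet_iso (QuotientGroup.mk' M) (QuotientGroup.mk' M)
      (FinGSet.ofQuotient M (cosetSet K) (le_ker_toPermHom_cosetSet (hM.trans hK)))
    rw [RBurnside.cls_eq (FinBiset.prod_congr h1 (FinBiset.tildeSet_congr h2)),
      RBurnside.cls_eq h3, RBurnside.cls_eq
        (FinBiset.prod_congr ((FinGSet.Iso.equivalence _).refl _) h1),
      RBurnside.cls_eq (FinBiset.tildeSet_prod_iso _ _), RBurnside.cls_eq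
        (FinBiset.twist_congr _ h2)]
  · rw [moebius_top_eq_zero (frattini G) (fun _ => frattini_nongenerating) K hK]
    simp

/-! ### Deflation and inflation -/

/-- The set `G / P` as a `(G / N, G)`-biset, for `N ≤ P`. -/
def defInfBiset (N P : Subgroup G) [N.Normal] [P.Normal] (h : N ≤ P) : FinBiset (G ⧸ N) G :=
  FinBiset.ofHoms (QuotientGroup.map N P (MonoidHom.id G) h) (QuotientGroup.mk' P)

/-- If $xNM=yNM$, write $x^{-1}y=nm$; then $xn$ lifts both $xN$ and $yM$, so $G$ surjects onto the
fibre product. The result sees $M$ only through $NM$, as Weisner's theorem requires. -/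
theorem def_comp_diag (N M P : Subgroup G) [N.Normal] [M.Normal] [P.Normal] (hP : N ⊔ M = P) :
    comp R (RBurnside.cls R (defBiset N)) (RBurnside.cls R (cosetBiset (diag M))) =
      RBurnside.cls R (defInfBiset N P (hP ▸ le_sup_left)) := by
  have hNP : N ≤ P := hP ▸ le_sup_left
  have hMP : M ≤ P := hP ▸ le_sup_right
  rw [comp_cls, RBurnside.cls_eq (FinBiset.prod_congr ((FinGSet.Iso.equivalence _).refl _)
    (FinBiset.cosetBiset_diag_iso M))]
  refine RBurnside.cls_eq (FinBiset.prod_ofHoms_iso _ _ _ _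
    (QuotientGroup.map N P (MonoidHom.id G) hNP) (QuotientGroup.map M P (MonoidHom.id G) hMP)
    (fun _ => rfl) ?_ ?_)
  · rintro ⟨x⟩
    exact ⟨(x : G ⧸ N), 1, mul_one _⟩
  · rintro ⟨x⟩ ⟨y⟩ (h : (x : G ⧸ P) = (y : G ⧸ P))
    have h' := QuotientGroup.eq.1 h
    rw [← hP, Subgroup.mem_sup_of_normal_left] at h'
    obtain ⟨n, hn, m, hm, hnm⟩ := h'
    refine ⟨x * n, (QuotientGroup.eq.2 (by simpa using hn)).symm, QuotientGroup.eq.2 ?_⟩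
    have : (x * n)⁻¹ * y = m := by
      rw [mul_inv_rev, mul_assoc, ← hnm, inv_mul_cancel_left]
    rwa [this]

/-- `(G × G) / Δ_M(G)` factors through deflation to `G / M`. -/
theorem inf_comp_def (M : Subgroup G) [M.Normal] :
    comp R (RBurnside.cls R (FinBiset.ofHoms (QuotientGroup.mk' M) (MonoidHom.id (G ⧸ M))))
      (RBurnside.cls R (defBiset M)) = RBurnside.cls R (cosetBiset (diag M)) := by
  rw [comp_cls, RBurnside.cls_eq (FinBiset.cosetBiset_diag_iso M)]
  exact RBurnside.cls_eq (FinBiset.prod_ofHoms_iso _ _ _ _ (MonoidHom.id _) (MonoidHom.id _)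
    (fun _ => rfl) (fun x => ⟨x, 1, mul_one x⟩) (fun t s h => ⟨t, rfl, h⟩))

/-- Transitivity of deflation. -/
theorem def_comp_def {L N : Subgroup G} [L.Normal] [N.Normal] (h : L ≤ N) :
    comp R (RBurnside.cls R (FinBiset.ofHoms (MonoidHom.id (G ⧸ N))
      (QuotientGroup.map L N (MonoidHom.id G) h))) (RBurnside.cls R (defBiset L)) =
        RBurnside.cls R (defBiset N) := by
  rw [comp_cls]
  exact RBurnside.cls_eq (FinBiset.prod_ofHoms_iso _ _ _ _ (MonoidHom.id _)
    (QuotientGroup.map L N (MonoidHom.id G) h)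
    (fun _ => rfl) (fun x => ⟨x, 1, by simp⟩) (fun t s h => ⟨s, h.symm, rfl⟩))

theorem diag_bot :
    RBurnside.cls R (cosetBiset (diag (⊥ : Subgroup G))) =
      RBurnside.cls R (FinBiset.idBiset G) := by
  rw [RBurnside.cls_eq (FinBiset.cosetBiset_diag_iso (⊥ : Subgroup G))]
  exact RBurnside.cls_eq (FinBiset.ofHoms_congr_iso (QuotientGroup.quotientBot) _ _)

end

/-! ### The action of bisets on biset functors -/

section

variable {R : Type v} [CommRing R] (F : BisetCat.{u} R ⥤ ModuleCat.{w} R)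
  {G H K : Type u} [Group G] [Finite G] [Group H] [Finite H] [Group K] [Finite K]

theorem act_comp (a : RB R K H) (b : RB R H G) (x : F.obj (.of G)) :
    act F (comp R a b) x = act F a (act F b x) := by
  have h : BisetCat.hom (comp R a b) = BisetCat.hom b ≫ BisetCat.hom a := rfl
  rw [act, h, F.map_comp]
  rfl

theorem act_id (x : F.obj (.of G)) :
    act F (RBurnside.cls R (FinBiset.idBiset G)) x = x :=
  congrArg (fun f => f.hom x) (F.map_id (BisetCat.of G))

variable [F.Additive] [F.Linear R]

/-- The action of `RB(H, G)`, as a linear map. -/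
def actLinear : RB R H G →ₗ[R] F.obj (.of G) →ₗ[R] F.obj (.of H) where
  toFun := act F
  map_add' a b := by
    have h : BisetCat.hom (a + b) = BisetCat.hom a + BisetCat.hom b := rfl
    rw [act, h, F.map_add]
    rfl
  map_smul' r a := by
    have h : BisetCat.hom (r • a) = r • BisetCat.hom a := rfl
    rw [act, h, F.map_smul]
    rfl

theorem act_zero : act F (0 : RB R H G) = 0 := map_zero (actLinear F)

theorem act_smul (r : R) (a : RB R H G) (x : F.obj (.of G)) :
    act F (r • a) x = r • act F a x :=
  LinearMap.congr_fun (map_smul (actLinear F) r a) x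

theorem act_sum {ι : Type*} (s : Finset ι) (a : ι → RB R H G) (x : F.obj (.of G)) :
    act F (∑ i ∈ s, a i) x = ∑ i ∈ s, act F (a i) x :=
  (LinearMap.congr_fun (map_sum (actLinear F) a s) x).trans (LinearMap.sum_apply _ _ _)

/-- The term of $L<G$ factors through $\mathrm{Res}_L$. The term $L=G$ is the identity biset with
coefficient $|G|^{-1}|G|\mu(G,G)=1$. -/
theorem act_tilde_topIdempotent (hG : IsUnit (Nat.card G : R)) (x : F.obj (.of G))
    (hx : ∀ L : Subgroup G, L < ⊤ → res F L x = 0) :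
    act F (tilde R G (topIdempotent R G)) x = x := by
  have := Fintype.ofFinite (Subgroup G)
  rw [tilde_topIdempotent, act_smul, act_sum, Finset.sum_eq_single ⊤]
  · rw [act_smul, RBurnside.cls_eq FinBiset.tildeSet_coset_top_iso, act_id, moebius_self,
      Int.cast_one, mul_one, Subgroup.card_top, smul_smul, Ring.inverse_mul_cancel _ hG, one_smul]
  · intro L _ hL
    have h : act F (RBurnside.cls R (resBiset L)) x = 0 := hx L (lt_top_iff_ne_top.2 hL)
    rw [act_smul, ← RBurnside.cls_eq (FinBiset.ind_prod_res_iso L), ← comp_cls, act_comp, h,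
      map_zero, smul_zero]
  · simp

end

/-! ### Restrictions and deflations annihilate $\varphi_{\mathbf 1}^G$ -/

section

variable {R : Type v} [CommRing R] {G : Type u} [Group G] [Finite G]

theorem phiOne_eq_sum [Fintype (NormalSubgroup G)]
    [DecidablePred fun M : NormalSubgroup G => M.1 ≤ frattini G] :
    phiOne R G = ∑ M : NormalSubgroup G with M.1 ≤ frattini G,
      (moebius (⟨⊥, inferInstance⟩ : NormalSubgroup G) M : R) • Y R (diag M.1) := by
  classical
  rw [phiOne, phi, finsum_eq_sum_of_fintype, Finset.sum_filter]
  refine Finset.sum_congr rfl fun M _ => ?_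
  have h : (⟨⊥, inferInstance⟩ : NormalSubgroup G) ≤ M := (bot_le : ⊥ ≤ M.1)
  rw [finsum_eq_if]
  simp only [h, true_and]

theorem res_comp_phiOne (hG : IsUnit (Nat.card G : R)) {H : Subgroup G} (hH : H ≠ ⊤) :
    comp R (RBurnside.cls R (resBiset H)) (phiOne R G) = 0 := by
  classical
  have := Fintype.ofFinite (NormalSubgroup G)
  rw [phiOne_eq_sum, map_sum]
  refine Finset.sum_eq_zero fun M _ => ?_
  rw [map_smul, Y, ← comp_assoc, ← comp_assoc, res_comp_tilde_topIdempotent hG hH]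
  simp

/-- Once the left `e` is moved to the right of the middle biset, the term of $M$ is $\mu(\mathbf
1,M)$ times a function of $NM$, and Weisner's theorem in the poset of normal subgroups applies
because $N\ne1$. -/
theorem def_comp_phiOne_of_le_frattini (N : Subgroup G) [hN : N.Normal] (hN1 : N ≠ ⊥)
    (hNF : N ≤ frattini G) :
    comp R (RBurnside.cls R (defBiset N)) (phiOne R G) = 0 := by
  classical
  have := Fintype.ofFinite (NormalSubgroup G)
  let a : NormalSubgroup G := ⟨N, hN⟩
  let j : NormalSubgroup G → NormalSubgroup G := fun M => ⟨N ⊔ M.1, inferInstance⟩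
  -- Since $N\le\Phi(G)$, the conditions $M\le\Phi(G)$ and $NM\le\Phi(G)$ agree; extending by zero
  -- outside $\Phi(G)$ lets the sum run over all normal $M$. The inner default is never reached, as
  -- $N\le NM$.
  let f : NormalSubgroup G → RB R (G ⧸ N) G := fun P =>
    if P.1 ≤ frattini G then
      if h : N ≤ P.1 then comp R (comp R (RBurnside.cls R (defInfBiset N P.1 h))
        (tilde R G (topIdempotent R G))) (tilde R G (topIdempotent R G)) else 0
    else 0
  let : OrderBot (NormalSubgroup G) :=
    { bot := ⟨⊥, inferInstance⟩, bot_le := fun M => (bot_le : ⊥ ≤ M.1) }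
  rw [phiOne_eq_sum, map_sum, Finset.sum_filter]
  refine Eq.trans ?_ (sum_smul_comp_sup_eq_zero (moebius (⊥ : NormalSubgroup G)) a j
    (fun x b => (sup_le_iff.trans and_comm : N ⊔ x.1 ≤ b.1 ↔ _))
    (fun b hb => sum_Iic_moebius b fun h => hN1 (le_bot_iff.1
      (show N ≤ ⊥ from (h ▸ hb : a ≤ (⊥ : NormalSubgroup G))))) f)
  refine Finset.sum_congr rfl fun M _ => ?_
  by_cases hM : M.1 ≤ frattini G
  · have hj : (j M).1 ≤ frattini G := sup_le hNF hM
    have hNj : N ≤ (j M).1 := le_sup_left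
    rw [if_pos hM, map_smul, Int.cast_smul_eq_zsmul]
    simp only [f, if_pos hj, dif_pos hNj]
    rw [Y, tilde_topIdempotent_comp_diag M.1 hM, ← comp_assoc, ← comp_assoc,
      def_comp_diag N M.1 (j M).1 rfl]
    rfl
  · have hj : ¬ (j M).1 ≤ frattini G := fun h => hM (le_sup_right.trans h)
    simp only [f, if_neg hM, if_neg hj, smul_zero]

/-- Deflation to $G/N$ factors through deflation to $G/(N\cap\Phi(G))$. -/
theorem def_comp_phiOne (N : Subgroup G) [N.Normal] (hN : N ⊓ frattini G ≠ ⊥) :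
    comp R (RBurnside.cls R (defBiset N)) (phiOne R G) = 0 := by
  rw [← def_comp_def (inf_le_left : N ⊓ frattini G ≤ N), comp_assoc,
    def_comp_phiOne_of_le_frattini _ hN inf_le_right, map_zero]

end

/-! ### Elements fixed by $\varphi_{\mathbf 1}^G$, and the characterization -/

section

variable {R : Type v} [CommRing R] (F : BisetCat.{u} R ⥤ ModuleCat.{w} R)
  {G : Type u} [Group G] [Finite G]

theorem act_diag_of_defl_eq_zero (M : Subgroup G) [M.Normal] (x : F.obj (.of G))
    (hx : defl F M x = 0) : act F (RBurnside.cls R (cosetBiset (diag M))) x = 0 := by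
  have h : act F (RBurnside.cls R (defBiset M)) x = 0 := hx
  rw [← inf_comp_def, act_comp, h, map_zero]

variable [F.Additive] [F.Linear R]

/-- Terms with $M\ne1$ factor, after `e` has fixed $x$, through $\mathrm{Def}_{G/M}$. For $M=1$ the
middle biset is the identity, so `e` acts twice and fixes $x$. -/
theorem act_phiOne (x : F.obj (.of G)) (he : act F (tilde R G (topIdempotent R G)) x = x)
    (hd : ∀ (M : Subgroup G) [M.Normal], M ≤ frattini G → M ≠ ⊥ → defl F M x = 0) :
    act F (phiOne R G) x = x := by
  classical
  have := Fintype.ofFinite (NormalSubgroup G)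
  rw [phiOne_eq_sum, act_sum, Finset.sum_eq_single (⟨⊥, inferInstance⟩ : NormalSubgroup G)]
  · rw [moebius_self, Int.cast_one, one_smul, Y, act_comp, he, act_comp, diag_bot, act_id, he]
  · intro M hM hM1
    have h := act_diag_of_defl_eq_zero F M.1 x
      (hd M.1 (Finset.mem_filter.1 hM).2 fun h => hM1 (Subtype.ext h))
    rw [act_smul, Y, act_comp, he, act_comp, h, map_zero, smul_zero]
  · intro h
    simp at h

end

end BisetFunctors

end

theorem mainTheorem12 {R : Type v} [CommRing R]
    (F : BisetFunctors.BisetCat.{u} R ⥤ ModuleCat.{w} R) [F.Additive] [F.Linear R]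
    (G : Type u) [Group G] [Finite G] (hG : IsUnit (Nat.card G : R)) :
    (BisetFunctors.deltaPhi F G : Set (F.obj (.of G))) =
      {x : F.obj (.of G) |
        (∀ H : Subgroup G, H < ⊤ → BisetFunctors.res F H x = 0) ∧
        (∀ (N : Subgroup G) [N.Normal], N ⊓ frattini G ≠ ⊥ → BisetFunctors.defl F N x = 0)} := by
  ext x
  constructor
  · rintro ⟨y, rfl⟩
    refine ⟨fun H hH => ?_, fun N _ hN => ?_⟩
    · rw [BisetFunctors.res, ← BisetFunctors.act_comp,
        BisetFunctors.res_comp_phiOne hG hH.ne, BisetFunctors.act_zero, LinearMap.zero_apply]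
    · rw [BisetFunctors.defl, ← BisetFunctors.act_comp, BisetFunctors.def_comp_phiOne N hN,
        BisetFunctors.act_zero, LinearMap.zero_apply]
  · rintro ⟨hres, hdef⟩
    -- The element is its own preimage; for $M\le\Phi(G)$ the intersection $M\cap\Phi(G)$ is $M$.
    exact ⟨x, BisetFunctors.act_phiOne F x
      (BisetFunctors.act_tilde_topIdempotent F hG x hres)
      fun M _ hMF hM => hdef M (by rwa [inf_eq_left.2 hMF])⟩
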